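/- Let $\mathbf{k}$ be a field, $G$ a finite abelian group, $n\ge 0$, $g_1,\dots,g_n\in G$, and let $\chi_1,\dots,\chi_n\colon G\to\mathbf{k}^*$ be characters. Put $q_{ij}=\chi_j(g_i)$ and assume $q_{ii}\ne 1$ for all $i$ and $q_{ij}q_{ji}=1$ for $i\ne j$. Let $m_i$ be the order of $q_{ii}$. Let $\lambda_i\in\mathbf{k}$ and $\lambda_{ij}\in\mathbf{k}$ ($i\neq j$) satisfy $\lambda_i(\chi_i(h)^{m_i}-1)=0$ and $\lambda_{ij}(\chi_i(h)\chi_j(h)-1)=0$ for all $h\in G$, and $\lambda_{ij}+q_{ij}\lambda_{ji}=0$ for $i\ne j$. Let $H$ be the corresponding lifting of a quantum linear space, that is, the $\mathbf{k}$-algebra generated by $G$ (with the relations of $G$) and $x_1,\dots,x_n$, subject to $$gx_i=\chi_i(g)x_ig,\qquad x_ix_j=q_{ij}x_jx_i+\lambda_{ij}(1-g_ig_j)\ (i\neq j),\qquad x_i^{m_i}=\lambda_i(1-g_i^{m_i}),$$ with comultiplication $\Delta(g)=g\otimes g$, $\Delta(x_i)=g_i\otimes x_i+x_i\otimes 1$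 and counit $\varepsilon(g)=1$, $\varepsilon(x_i)=0$. A right integral in $H^*$ is a $\varphi\in H^*$ with $\varphi(h_{(1)})f(h_{(2)})=f(1)\varphi(h)$ for all $f\in H^*$, $h\in H$; a right integral in $H$ is a $t\in H$ with $th=\varepsilon(h)t$ for all $h\in H$; a modular element is an $\alpha\in H^*$ such that $ht=\alpha(h)t$ for all $h\in H$ and some nonzero right integral $t$ in $H$. Then: 1. $H^*$ has a nonzero right integral, and $H$ has a modular element. 2. The elements $(x_1g_1^{-1})^{r_1}\cdots(x_ng_n^{-1})^{r_n}g$ with $0\le r_i<m_i$ and $g\in G$ form a basis of $H$. 3. For every nonzero right integral $\varphi\in H^*$, the map $H\to H^*$, $x\mapsto\varphi(\,\cdot\,x)$, is bijective, and there is exactly one algebra automorphism $\rho$ of $H$ (the Nakayama automorphism) with $\varphi(yx)=\varphi(\rho(x)y)$ for all $x,y\in H$. For this $\rho$: - (a) every basis element in 2 is an eigenvector of $\rho$, and the map sending $(r_1,\dots,r_n,g)$ to the eigenvalue of $(x_1g_1^{-1})^{r_1}\cdots(x_ng_n^{-1})^{r_n}g$ is a group homomorphism $\theta\colon\mathbb{Z}_{m_1}\times\cdots\times\mathbb{Z}_{m_n}\times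 G\to\mathbf{k}^*$; - (b) for every modular element $\alpha$, the set of eigenvalues of $\rho$ is the subgroup $L_1=\langle q_{11},\dots,q_{nn},\alpha(G)\rangle$ of $\mathbf{k}^*$, $H=\bigoplus_{\omega\in L_1}H_\omega$ with $H_\omega=\{h\in H:\rho(h)=\omega h\}$, and all the eigenspaces $H_\omega$, $\omega\in L_1$, have the same dimension. -/

import Mathlib

open scoped TensorProduct

/-! ### A `q`-binomial identity

If `A * B = q • (B * A)` and `q` is a primitive `m`-th root of unity, then
`(B + A) ^ m = B ^ m + A ^ m`.  It is needed for the comultiplication to be well defined. -/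

/-- Gaussian binomial coefficients at `q`, by the Pascal recursion. -/
def gaussBinom {k : Type*} [Field k] (q : k) : ℕ → ℕ → k
  | _, 0 => 1
  | 0, _ + 1 => 0
  | n + 1, j + 1 => gaussBinom q n j + q ^ (j + 1) * gaussBinom q n (j + 1)

theorem gaussBinom_zero_right {k : Type*} [Field k] (q : k) (n : ℕ) :
    gaussBinom q n 0 = 1 := by
  cases n <;> rfl

theorem gaussBinom_succ_succ {k : Type*} [Field k] (q : k) (n j : ℕ) :
    gaussBinom q (n + 1) (j + 1)
      = gaussBinom q n j + q ^ (j + 1) * gaussBinom q n (j + 1) := rfl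

theorem gaussBinom_of_lt {k : Type*} [Field k] (q : k) (n : ℕ) :
    ∀ j, n < j → gaussBinom q n j = 0 := by
  induction n with
  | zero => intro j hj; cases j with
    | zero => omega
    | succ j => rfl
  | succ n ih => intro j hj; cases j with
    | zero => omega
    | succ j => rw [gaussBinom_succ_succ, ih j (by omega), ih (j + 1) (by omega)]; ring

theorem gaussBinom_self {k : Type*} [Field k] (q : k) (n : ℕ) :
    gaussBinom q n n = 1 := by
  induction n with
  | zero => rfl
  | succ n ih => rw [gaussBinom_succ_succ, ih, gaussBinom_of_lt q n (n + 1) (by omega)]; ring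

theorem gaussBinom_absorb {k : Type*} [Field k] (q : k) (n : ℕ) :
    ∀ j, (1 - q ^ (j + 1)) * gaussBinom q (n + 1) (j + 1)
      = (1 - q ^ (n + 1)) * gaussBinom q n j := by
  induction n with
  | zero =>
    intro j
    cases j with
    | zero => simp [gaussBinom]
    | succ j => simp [gaussBinom]
  | succ n ih =>
    intro j
    rw [gaussBinom_succ_succ q (n + 1) j]
    cases j with
    | zero =>
      have h := ih 0
      simp only [gaussBinom_zero_right] at h ⊢
      linear_combination q ^ (0 + 1) * h
    | succ j =>
      have h1 := ih (j + 1)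
      have h2 := ih j
      have h3 := gaussBinom_succ_succ q n j
      linear_combination q ^ (j + 1 + 1) * h1 + q * h2 - (q - q ^ (n + 2)) * h3

theorem qcomm_mul_pow {k E : Type*} [Field k] [Ring E] [Algebra k E] {q : k} {A B : E}
    (h : A * B = q • (B * A)) (j : ℕ) : A * B ^ j = q ^ j • (B ^ j * A) := by
  induction j with
  | zero => simp
  | succ j ih =>
    rw [pow_succ, ← mul_assoc, ih, smul_mul_assoc, mul_assoc, h, mul_smul_comm, smul_smul,
      ← mul_assoc, pow_succ]

theorem qcomm_add_pow {k E : Type*} [Field k] [Ring E] [Algebra k E] {q : k} {A B : E}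
    (h : A * B = q • (B * A)) (n : ℕ) :
    (B + A) ^ n = ∑ j ∈ Finset.range (n + 1), gaussBinom q n j • (B ^ j * A ^ (n - j)) := by
  induction n with
  | zero => simp [gaussBinom]
  | succ n ih =>
    rw [pow_succ', ih, add_mul, Finset.mul_sum, Finset.mul_sum, Finset.sum_range_succ' _ (n + 1)]
    have hB : ∀ j ∈ Finset.range (n + 1), B * gaussBinom q n j • (B ^ j * A ^ (n - j))
        = gaussBinom q n j • (B ^ (j + 1) * A ^ (n + 1 - (j + 1))) := by
      intro j _
      rw [mul_smul_comm, ← mul_assoc, ← pow_succ', Nat.add_sub_add_right]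
    have hA : ∀ j ∈ Finset.range (n + 1), A * gaussBinom q n j • (B ^ j * A ^ (n - j))
        = (q ^ j * gaussBinom q n j) • (B ^ j * A ^ (n + 1 - j)) := by
      intro j hj
      rw [Finset.mem_range] at hj
      rw [mul_smul_comm, ← mul_assoc, qcomm_mul_pow h, smul_mul_assoc, mul_assoc, ← pow_succ',
        smul_smul, mul_comm, show n - j + 1 = n + 1 - j by omega]
    rw [Finset.sum_congr rfl hB, Finset.sum_congr rfl hA,
      Finset.sum_range_succ' (fun j => (q ^ j * gaussBinom q n j) • (B ^ j * A ^ (n + 1 - j))) n]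
    have hs : ∑ j ∈ Finset.range (n + 1), gaussBinom q (n + 1) (j + 1) •
          (B ^ (j + 1) * A ^ (n + 1 - (j + 1)))
        = ∑ j ∈ Finset.range (n + 1), gaussBinom q n j • (B ^ (j + 1) * A ^ (n + 1 - (j + 1)))
        + ∑ j ∈ Finset.range n, (q ^ (j + 1) * gaussBinom q n (j + 1)) •
          (B ^ (j + 1) * A ^ (n + 1 - (j + 1))) := by
      simp only [gaussBinom_succ_succ, add_smul, Finset.sum_add_distrib]
      congr 1
      rw [Finset.sum_range_succ, gaussBinom_of_lt q n (n + 1) (by omega)]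
      simp
    rw [hs]
    simp only [gaussBinom_zero_right, pow_zero, mul_one]
    rw [add_assoc]

theorem qcomm_add_pow_orderOf {k E : Type*} [Field k] [Ring E] [Algebra k E] {q : kˣ} {A B : E}
    (h : A * B = (q : k) • (B * A)) (hq : 0 < orderOf q) :
    (B + A) ^ orderOf q = A ^ orderOf q + B ^ orderOf q := by
  obtain ⟨m, hm⟩ : ∃ m, orderOf q = m + 1 := ⟨orderOf q - 1, by omega⟩
  have hq1 : (q : k) ^ (m + 1) = 1 := by
    rw [← hm, ← Units.val_pow_eq_pow_val, pow_orderOf_eq_one, Units.val_one]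
  rw [qcomm_add_pow h, hm, Finset.sum_range_succ, Finset.sum_range_succ', gaussBinom_self]
  have hz : ∀ j ∈ Finset.range m, gaussBinom (q : k) (m + 1) (j + 1) •
      (B ^ (j + 1) * A ^ (m + 1 - (j + 1))) = 0 := by
    intro j hj
    rw [Finset.mem_range] at hj
    have h1 := gaussBinom_absorb (q : k) m j
    rw [hq1, sub_self, zero_mul] at h1
    have h2 : (1 : k) - (q : k) ^ (j + 1) ≠ 0 := by
      intro h0
      have h3 : q ^ (j + 1) = 1 := by
        ext
        push_cast
        exact (sub_eq_zero.mp h0).symm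
      exact pow_ne_one_of_lt_orderOf (by omega) (by omega) h3
    rw [(mul_eq_zero.mp h1).resolve_left h2, zero_smul]
  rw [Finset.sum_eq_zero hz]
  simp [gaussBinom_zero_right]

/-! ### Integrals, Frobenius homomorphisms, Nakayama automorphisms -/

/-- `φ` is a Frobenius homomorphism of `A`: the map `x ↦ xφ` from `A` to its dual,
`(xφ)(y) = φ (y x)`, is bijective (it is always a homomorphism of left `A`-modules). -/
def IsFrobeniusHom {k A : Type*} [Field k] [Ring A] [Algebra k A] (φ : Module.Dual k A) : Prop :=
  Function.Bijective fun x : A => (φ ∘ₗ LinearMap.mulRight k x : Module.Dual k A)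

/-- `ρ` is the Nakayama automorphism of `A` with respect to `φ`: `xφ = φρ(x)` for all `x`, where
`(xφ)(y) = φ (y x)` and `(φx)(y) = φ (x y)`. -/
def IsNakayamaAut {k A : Type*} [Field k] [Ring A] [Algebra k A] (φ : Module.Dual k A)
    (ρ : A ≃ₐ[k] A) : Prop :=
  ∀ x y : A, φ (y * x) = φ (ρ x * y)

/-- `φ` is a right integral in the dual algebra of `A`: `φ * f = f(1) φ` for all `f`, with the
convolution product `(φ * f)(a) = φ(a₁) f(a₂)`. -/
def IsRightIntegralDual {k A : Type*} [Field k] [Ring A] [Bialgebra k A]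
    (φ : Module.Dual k A) : Prop :=
  ∀ f : Module.Dual k A,
    LinearMap.mul' k k ∘ₗ TensorProduct.map φ f ∘ₗ Coalgebra.comul = f 1 • φ

/-- `t` is a right integral in `A`. -/
def IsRightIntegral {k A : Type*} [Field k] [Ring A] [Bialgebra k A] (t : A) : Prop :=
  ∀ a : A, t * a = Coalgebra.counit (R := k) a • t

/-- `α` is the modular element of `A`: `a t = α(a) t` for a nonzero right integral `t` in `A`. -/
def IsModularElement {k A : Type*} [Field k] [Ring A] [Bialgebra k A]
    (α : Module.Dual k A) : Prop :=
  ∃ t : A, t ≠ 0 ∧ IsRightIntegral (k := k) t ∧ ∀ a : A, a * t = α a • t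

/-! ### Liftings of quantum linear spaces -/

/-- The data `(𝐠, χ, λ)` defining a lifting of a quantum linear space over the abelian group `G`.
The diagonal values `lamLink i i` play no role. -/
structure LiftingDatum (k G : Type*) [Field k] [CommGroup G] (n : ℕ) where
  g : Fin n → G
  χ : Fin n → (G →* kˣ)
  lam : Fin n → k
  lamLink : Fin n → Fin n → k
  χ_self_ne_one : ∀ i, χ i (g i) ≠ 1
  χ_mul_χ : ∀ i j, i ≠ j → χ i (g j) * χ j (g i) = 1
  lam_mul : ∀ i (h : G), lam i * ((χ i h : k) ^ orderOf (χ i (g i)) - 1) = 0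
  lamLink_mul : ∀ i j, i ≠ j → ∀ h : G, lamLink i j * ((χ i h : k) * (χ j h : k) - 1) = 0
  lamLink_add : ∀ i j, i ≠ j → lamLink i j + (χ j (g i) : k) * lamLink j i = 0

namespace LiftingDatum

variable {k G : Type*} [Field k] [CommGroup G] {n : ℕ} (D : LiftingDatum k G n)

/-- The braiding scalars `q i j = χ_j(g_i)`. -/
def q (i j : Fin n) : kˣ := D.χ j (D.g i)

/-- `m i` is the order of `q i i`. -/
noncomputable def m (i : Fin n) : ℕ := orderOf (D.q i i)

/-- Generator of the free algebra attached to a group element. -/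
def fg (_ : LiftingDatum k G n) (h : G) : FreeAlgebra k (G ⊕ Fin n) := FreeAlgebra.ι k (Sum.inl h)

/-- Generator of the free algebra attached to an index. -/
def fx (_ : LiftingDatum k G n) (i : Fin n) : FreeAlgebra k (G ⊕ Fin n) :=
  FreeAlgebra.ι k (Sum.inr i)

/-- The defining relations: those of the group `G`, and the three families of relations
involving the `x_i`. -/
inductive Rel : FreeAlgebra k (G ⊕ Fin n) → FreeAlgebra k (G ⊕ Fin n) → Prop
  | one : Rel (D.fg 1) 1
  | mul (a b : G) : Rel (D.fg (a * b)) (D.fg a * D.fg b)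
  | comm (h : G) (i : Fin n) : Rel (D.fg h * D.fx i) ((D.χ i h : k) • (D.fx i * D.fg h))
  | link (i j : Fin n) (hij : i ≠ j) : Rel (D.fx i * D.fx j)
      ((D.q i j : k) • (D.fx j * D.fx i) + D.lamLink i j • (1 - D.fg (D.g i * D.g j)))
  | power (i : Fin n) : Rel (D.fx i ^ D.m i) (D.lam i • (1 - D.fg (D.g i ^ D.m i)))

/-- The lifting `H(𝐠, χ, λ)`, as an algebra given by generators and relations. -/
def H : Type _ := RingQuot D.Rel

noncomputable instance : Ring D.H := inferInstanceAs (Ring (RingQuot D.Rel))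

noncomputable instance : Algebra k D.H := inferInstanceAs (Algebra k (RingQuot D.Rel))

/-- The quotient map from the free algebra. -/
noncomputable def proj : FreeAlgebra k (G ⊕ Fin n) →ₐ[k] D.H := RingQuot.mkAlgHom k D.Rel

/-- The group elements of `H`. -/
noncomputable def grp : G →* D.H where
  toFun h := D.proj (D.fg h)
  map_one' := (RingQuot.mkAlgHom_rel k Rel.one).trans (map_one D.proj)
  map_mul' a b := (RingQuot.mkAlgHom_rel k (Rel.mul a b)).trans (map_mul D.proj _ _)

/-- The generators `x_i` of `H`. -/
noncomputable def x (i : Fin n) : D.H := D.proj (D.fx i)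

theorem proj_rel {a b : FreeAlgebra k (G ⊕ Fin n)} (h : D.Rel a b) : D.proj a = D.proj b :=
  RingQuot.mkAlgHom_rel k h

theorem grp_mul_x (h : G) (i : Fin n) :
    D.grp h * D.x i = (D.χ i h : k) • (D.x i * D.grp h) := by
  have := D.proj_rel (Rel.comm h i)
  rw [map_smul, map_mul, map_mul] at this
  exact this

theorem x_mul_x {i j : Fin n} (hij : i ≠ j) :
    D.x i * D.x j = (D.q i j : k) • (D.x j * D.x i)
      + D.lamLink i j • (1 - D.grp (D.g i * D.g j)) := by
  have := D.proj_rel (Rel.link i j hij)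
  rw [map_add, map_smul, map_smul, map_mul, map_mul, map_sub, map_one] at this
  exact this

theorem x_pow (i : Fin n) : D.x i ^ D.m i = D.lam i • (1 - D.grp (D.g i ^ D.m i)) := by
  have := D.proj_rel (Rel.power i)
  rw [map_pow, map_smul, map_sub, map_one] at this
  exact this

/-- The universal property of `H`. -/
noncomputable def lift {E : Type*} [Ring E] [Algebra k E] (γ : G →* E) (ξ : Fin n → E)
    (hcomm : ∀ h i, γ h * ξ i = (D.χ i h : k) • (ξ i * γ h))
    (hlink : ∀ i j, i ≠ j → ξ i * ξ j
      = (D.q i j : k) • (ξ j * ξ i) + D.lamLink i j • (1 - γ (D.g i * D.g j)))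
    (hpow : ∀ i, ξ i ^ D.m i = D.lam i • (1 - γ (D.g i ^ D.m i))) : D.H →ₐ[k] E :=
  RingQuot.liftAlgHom k ⟨FreeAlgebra.lift k (Sum.elim γ ξ), by
    intro a b hab
    cases hab with
    | one => simp [fg]
    | mul a b => simp [fg]
    | comm h i => simpa [fg, fx] using hcomm h i
    | link i j hij => simpa [fg, fx] using hlink i j hij
    | power i => simpa [fg, fx] using hpow i⟩

section lift

variable {E : Type*} [Ring E] [Algebra k E] (γ : G →* E) (ξ : Fin n → E)
    (hcomm : ∀ h i, γ h * ξ i = (D.χ i h : k) • (ξ i * γ h))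
    (hlink : ∀ i j, i ≠ j → ξ i * ξ j
      = (D.q i j : k) • (ξ j * ξ i) + D.lamLink i j • (1 - γ (D.g i * D.g j)))
    (hpow : ∀ i, ξ i ^ D.m i = D.lam i • (1 - γ (D.g i ^ D.m i)))

theorem lift_grp (h : G) : D.lift γ ξ hcomm hlink hpow (D.grp h) = γ h :=
  (RingQuot.liftAlgHom_mkAlgHom_apply _ _ _ _).trans (by simp [fg])

theorem lift_x (i : Fin n) : D.lift γ ξ hcomm hlink hpow (D.x i) = ξ i :=
  (RingQuot.liftAlgHom_mkAlgHom_apply _ _ _ _).trans (by simp [fx])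

end lift

theorem algHom_ext {E : Type*} [Ring E] [Algebra k E] {f f' : D.H →ₐ[k] E}
    (hg : ∀ h, f (D.grp h) = f' (D.grp h)) (hx : ∀ i, f (D.x i) = f' (D.x i)) : f = f' := by
  apply RingQuot.ringQuot_ext' k
  apply FreeAlgebra.hom_ext
  funext s
  cases s with
  | inl h => exact hg h
  | inr i => exact hx i

theorem m_pos [Finite G] (i : Fin n) : 0 < D.m i := by
  have h : IsOfFinOrder (D.q i i) := (D.χ i).isOfFinOrder (isOfFinOrder_of_finite (D.g i))
  exact h.orderOf_pos

/-- The group homomorphism `g ↦ g ⊗ g`. -/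
noncomputable def comulGrp : G →* D.H ⊗[k] D.H where
  toFun h := D.grp h ⊗ₜ[k] D.grp h
  map_one' := by simp [Algebra.TensorProduct.one_def]
  map_mul' a b := by simp

theorem comulGrp_apply (h : G) : D.comulGrp h = D.grp h ⊗ₜ[k] D.grp h := rfl

section bialgebra

variable [Finite G]

/-- The comultiplication, `g ↦ g ⊗ g` and `x_i ↦ g_i ⊗ x_i + x_i ⊗ 1`. -/
noncomputable def comulHom : D.H →ₐ[k] D.H ⊗[k] D.H :=
  D.lift D.comulGrp
    (fun i => D.grp (D.g i) ⊗ₜ[k] D.x i + D.x i ⊗ₜ[k] 1)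
    (by
      intro h i
      simp only [comulGrp_apply, mul_add, add_mul,
        Algebra.TensorProduct.tmul_mul_tmul, grp_mul_x, ← map_mul, mul_comm h, smul_add,
        TensorProduct.tmul_smul, TensorProduct.smul_tmul', mul_one, one_mul])
    (by
      intro i j hij
      have hq : (D.q i j : k) * (D.q j i : k) = 1 := by
        rw [← Units.val_mul, q, q, mul_comm, D.χ_mul_χ i j hij]; rfl
      have e1 : D.grp (D.g i) * D.x j = (D.q i j : k) • (D.x j * D.grp (D.g i)) := D.grp_mul_x _ _
      have e2 : D.grp (D.g j) * D.x i = (D.q j i : k) • (D.x i * D.grp (D.g j)) := D.grp_mul_x _ _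
      simp only [comulGrp_apply, mul_add, add_mul,
        Algebra.TensorProduct.tmul_mul_tmul, mul_one, one_mul, e1, e2, D.x_mul_x hij,
        ← map_mul, mul_comm (D.g j) (D.g i), smul_add, smul_sub,
        TensorProduct.tmul_add, TensorProduct.add_tmul, TensorProduct.tmul_sub,
        TensorProduct.sub_tmul, TensorProduct.tmul_smul, ← TensorProduct.smul_tmul', smul_smul, hq,
        one_smul, Algebra.TensorProduct.one_def]
      abel)
    (by
      intro i
      have h : (D.grp (D.g i) ⊗ₜ[k] D.x i) * (D.x i ⊗ₜ[k] (1 : D.H))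
          = (D.q i i : k) • ((D.x i ⊗ₜ[k] (1 : D.H)) * (D.grp (D.g i) ⊗ₜ[k] D.x i)) := by
        rw [Algebra.TensorProduct.tmul_mul_tmul, Algebra.TensorProduct.tmul_mul_tmul,
          D.grp_mul_x, one_mul, mul_one, TensorProduct.smul_tmul']
        rfl
      rw [add_comm, m, qcomm_add_pow_orderOf h (D.m_pos i), ← m]
      simp only [Algebra.TensorProduct.tmul_pow, x_pow, one_pow, ← map_pow, comulGrp_apply, TensorProduct.tmul_smul, ← TensorProduct.smul_tmul', ← smul_add,
        TensorProduct.tmul_sub, TensorProduct.sub_tmul, Algebra.TensorProduct.one_def]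
      congr 1
      abel)

@[simp] theorem comulHom_grp (h : G) : D.comulHom (D.grp h) = D.grp h ⊗ₜ[k] D.grp h :=
  D.lift_grp _ _ _ _ _ h

@[simp] theorem comulHom_x (i : Fin n) :
    D.comulHom (D.x i) = D.grp (D.g i) ⊗ₜ[k] D.x i + D.x i ⊗ₜ[k] 1 :=
  D.lift_x _ _ _ _ _ i

/-- The counit, `g ↦ 1` and `x_i ↦ 0`. -/
noncomputable def counitHom : D.H →ₐ[k] k :=
  D.lift 1 (fun _ => 0) (by simp) (by simp) (by
    intro i
    simp [(D.m_pos i).ne'])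

@[simp] theorem counitHom_grp (h : G) : D.counitHom (D.grp h) = 1 :=
  D.lift_grp _ _ _ _ _ h

@[simp] theorem counitHom_x (i : Fin n) : D.counitHom (D.x i) = 0 :=
  D.lift_x _ _ _ _ _ i

/-- The bialgebra structure of `H(𝐠, χ, λ)`. -/
noncomputable instance : Bialgebra k D.H :=
  Bialgebra.ofAlgHom D.comulHom D.counitHom
    (D.algHom_ext (by simp) (by
      intro i
      simp [TensorProduct.tmul_add, TensorProduct.add_tmul, Algebra.TensorProduct.one_def,
        add_assoc]))
    (D.algHom_ext (by simp) (by simp))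
    (D.algHom_ext (by simp) (by simp))

end bialgebra

/-- The element `(x_1 g_1⁻¹)^{r_1} ⋯ (x_n g_n⁻¹)^{r_n} h` of `H`, in this order.  The exponent
`r_i ∈ ℤ / m_i` is represented by the natural number `(r i).val` with `0 ≤ (r i).val < m_i`. -/
noncomputable def monomial (r : ∀ i, ZMod (D.m i)) (h : G) : D.H :=
  (List.ofFn fun i => (D.x i * D.grp (D.g i)⁻¹) ^ (r i).val).prod * D.grp h

/-- The subgroup `L₁ = ⟨q_11, …, q_nn, α(G)⟩` of `kˣ`, for a linear form `α` on `H`. -/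
def L₁ (α : Module.Dual k D.H) : Subgroup kˣ :=
  Subgroup.closure
    ((Set.range fun i => D.q i i) ∪ {u : kˣ | ∃ h : G, (u : k) = α (D.grp h)})

/-- The component `H_ω = {h ∈ H : ρ(h) = ω h}`. -/
noncomputable def component (ρ : D.H ≃ₐ[k] D.H) (ω : k) : Submodule k D.H :=
  Module.End.eigenspace (ρ : D.H →ₗ[k] D.H) ω

end LiftingDatum

/-! ### Generators of `H` and straightening of words -/

namespace LiftingDatum

section

variable {k G : Type*} [Field k] [CommGroup G] {n : ℕ} (D : LiftingDatum k G n)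

/-! Everything is computed with y_i = x_i g_i⁻¹ and the monomials y^r h. They span because words can
be straightened one generator at a time. Their independence is a dimension count: let A be the
algebra of the datum without x_0. Moving x_0 past A is governed by a twist σ and a σ-derivation δ,
which exist because a ↦ [[σ a, δ a], [0, a]] respects the defining relations of A (`skewMat`). The
free A-module on 1, X, …, X^(m_0 - 1) then carries a representation of `H` generated by its first
basis vector (`rep`, `rep_surjective`), so dim H ≥ m_0 dim A, and induction gives the exact
dimension.

Since Δ(y_i) = 1 ⊗ y_i + y_i ⊗ g_i⁻¹, the coproduct of y^r h is a sum of terms y^s h ⊗ y^(r-s) h'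
over s ≤ r, with nonzero coefficients and without any reordering of the factors
(`comulHom_monomial`). Comparing coefficients shows that a right integral φ in the dual is, up to a
scalar, the coordinate function of one monomial of top degree. The same formula, read at a term of
maximal degree, shows that φ is nondegenerate (`isFrobeniusHom_integral`), whence the Nakayama
automorphism.

Let χ = ∏ χ_i^(m_i - 1). The shape of φ gives φ(hz) = χ(h) φ(zh) for h in G. The decisive identity
is φ(y_i z) = q_ii φ(z y_i) (`integral_y_mul`). It is not obtained by straightening y_i z, which
would bring in the linking parameters: the discrepancy of the two sides becomes, after translation
by g_i, a right integral, so a multiple cφ, and conjugation by g_i forces c = 0 because q_ii ≠ 1.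

Thus ρ multiplies y_i by q_ii⁻¹ and h by χ(h)⁻¹, so it is diagonal on the monomials with a character
θ as eigenvalue. Evaluating φ(ht) = χ(h) φ(th) at a right integral t identifies the modular element
on G with χ, so the image of θ is L₁. The eigenspaces are spanned by the cosets of ker θ, which all
have the same size. -/

/-- The universal property yields a map from `H` to `S` whose composite with the inclusion fixes the
generators, hence is the identity. -/
theorem subalgebra_eq_top (S : Subalgebra k D.H) (hg : ∀ h, D.grp h ∈ S) (hx : ∀ i, D.x i ∈ S) :
    S = ⊤ := by
  let γ : G →* S :=
    { toFun := fun h => ⟨D.grp h, hg h⟩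
      map_one' := by ext; simp
      map_mul' := fun a b => by ext; simp }
  let f : D.H →ₐ[k] S := D.lift γ (fun i => ⟨D.x i, hx i⟩)
    (fun h i => Subtype.ext (D.grp_mul_x h i))
    (fun i j hij => Subtype.ext (D.x_mul_x hij))
    (fun i => Subtype.ext (D.x_pow i))
  have hf : S.val.comp f = AlgHom.id k D.H := by
    refine D.algHom_ext (fun h => ?_) (fun i => ?_)
    · simp only [AlgHom.comp_apply, f, D.lift_grp]; rfl
    · simp only [AlgHom.comp_apply, f, D.lift_x]; rfl
  rw [eq_top_iff]
  intro a _
  have := DFunLike.congr_fun hf a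
  rw [AlgHom.comp_apply, AlgHom.id_apply] at this
  rw [← this]
  exact (f a).2

/-- A set of elements of `H` that is a subalgebra and contains the generators is everything. -/
theorem induction_on {p : D.H → Prop} (a : D.H) (hg : ∀ h, p (D.grp h)) (hx : ∀ i, p (D.x i))
    (hadd : ∀ a b, p a → p b → p (a + b)) (hmul : ∀ a b, p a → p b → p (a * b))
    (hsmul : ∀ (c : k) a, p a → p (c • a)) : p a := by
  have h1 : p 1 := by simpa using hg 1
  let S : Subalgebra k D.H :=
    { carrier := {a | p a}
      mul_mem' := fun ha hb => hmul _ _ ha hb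
      add_mem' := fun ha hb => hadd _ _ ha hb
      algebraMap_mem' := fun c => by
        rw [Algebra.algebraMap_eq_smul_one]
        exact hsmul c 1 h1 }
  have : a ∈ S := by rw [D.subalgebra_eq_top S hg hx]; trivial
  exact this

theorem grp_mul_grp_inv (h : G) : D.grp h * D.grp h⁻¹ = 1 := by
  rw [← map_mul, mul_inv_cancel, map_one]

theorem grp_inv_mul_grp (h : G) : D.grp h⁻¹ * D.grp h = 1 := by
  rw [← map_mul, inv_mul_cancel, map_one]

/-- The elements `y_i = x_i g_i⁻¹`. -/
noncomputable def y (i : Fin n) : D.H := D.x i * D.grp (D.g i)⁻¹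

theorem x_eq (i : Fin n) : D.x i = D.y i * D.grp (D.g i) := by
  rw [y, mul_assoc, grp_inv_mul_grp, mul_one]

theorem grp_mul_y (h : G) (i : Fin n) :
    D.grp h * D.y i = (D.χ i h : k) • (D.y i * D.grp h) := by
  rw [y, ← mul_assoc, grp_mul_x, smul_mul_assoc, mul_assoc, mul_assoc, ← map_mul, ← map_mul,
    mul_comm h]

theorem y_mul_grp (h : G) (i : Fin n) :
    D.y i * D.grp h = ((D.χ i h)⁻¹ : kˣ) • (D.grp h * D.y i) := by
  rw [grp_mul_y, Units.smul_def, smul_smul, Units.inv_mul, one_smul]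

theorem grp_mul_y_pow (h : G) (i : Fin n) (r : ℕ) :
    D.grp h * D.y i ^ r = (D.χ i h ^ r) • (D.y i ^ r * D.grp h) := by
  rw [qcomm_mul_pow (D.grp_mul_y h i) r, Units.smul_def, Units.val_pow_eq_pow_val]

theorem y_pow (i : Fin n) (r : ℕ) :
    ∃ u : kˣ, D.y i ^ r = u • (D.x i ^ r * D.grp ((D.g i)⁻¹ ^ r)) := by
  induction r with
  | zero => exact ⟨1, by simp⟩
  | succ r ih =>
    obtain ⟨u, hu⟩ := ih
    refine ⟨u * D.χ i ((D.g i)⁻¹ ^ r), ?_⟩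
    rw [pow_succ, hu, y, smul_mul_assoc, ← mul_assoc (_ * _), mul_assoc (D.x i ^ r), grp_mul_x,
      mul_smul, Units.smul_def (D.χ i _), mul_smul_comm, smul_mul_assoc, ← mul_assoc, ← pow_succ,
      mul_assoc, ← map_mul, ← pow_succ]

theorem monomial_eq (r : ∀ i, ZMod (D.m i)) (h : G) :
    D.monomial r h = (List.ofFn fun i => D.y i ^ (r i).val).prod * D.grp h := rfl

theorem monomial_mul_grp (r : ∀ i, ZMod (D.m i)) (h h' : G) :
    D.monomial r h * D.grp h' = D.monomial r (h * h') := by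
  rw [monomial_eq, mul_assoc, ← map_mul, monomial_eq]

theorem one_lt_m [Finite G] (i : Fin n) : 1 < D.m i := by
  have h1 := D.m_pos i
  have h2 : D.m i ≠ 1 := by
    rw [m, Ne, orderOf_eq_one_iff]
    exact D.χ_self_ne_one i
  omega

instance neZero_m [Finite G] (i : Fin n) : NeZero (D.m i) := ⟨(D.m_pos i).ne'⟩

end

/-! ### Removing the first generator, and spanning by monomials -/

section tail

variable {k G : Type*} [Field k] [CommGroup G] {n : ℕ} (D : LiftingDatum k G (n + 1))

/-- The datum obtained by forgetting the first generator. -/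
@[simps] def tail : LiftingDatum k G n where
  g i := D.g i.succ
  χ i := D.χ i.succ
  lam i := D.lam i.succ
  lamLink i j := D.lamLink i.succ j.succ
  χ_self_ne_one i := D.χ_self_ne_one i.succ
  χ_mul_χ i j hij := D.χ_mul_χ i.succ j.succ (by simpa using hij)
  lam_mul i := D.lam_mul i.succ
  lamLink_mul i j hij := D.lamLink_mul i.succ j.succ (by simpa using hij)
  lamLink_add i j hij := D.lamLink_add i.succ j.succ (by simpa using hij)

/-- The canonical map from the algebra of the truncated datum. -/
noncomputable def tailHom : D.tail.H →ₐ[k] D.H :=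
  D.tail.lift D.grp (fun i => D.x i.succ) (fun h i => D.grp_mul_x h i.succ)
    (fun i j hij => D.x_mul_x (i := i.succ) (j := j.succ) (by simpa using hij))
    (fun i => D.x_pow i.succ)

@[simp] theorem tailHom_grp (h : G) : D.tailHom (D.tail.grp h) = D.grp h :=
  D.tail.lift_grp _ _ _ _ _ h

@[simp] theorem tailHom_x (i : Fin n) : D.tailHom (D.tail.x i) = D.x i.succ :=
  D.tail.lift_x _ _ _ _ _ i

@[simp] theorem tailHom_y (i : Fin n) : D.tailHom (D.tail.y i) = D.y i.succ := by
  simp [y]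

theorem monomial_cons (s : ZMod (D.m 0)) (r : ∀ i, ZMod (D.tail.m i)) (h : G) :
    D.monomial (Fin.cons (α := fun i => ZMod (D.m i)) s r) h
      = D.y 0 ^ s.val * D.tailHom (D.tail.monomial r h) := by
  rw [monomial_eq, monomial_eq, List.ofFn_succ, List.prod_cons, map_mul, map_list_prod,
    List.map_ofFn, tailHom_grp, mul_assoc]
  have : (fun i : Fin n => D.y i.succ
      ^ (Fin.cons (α := fun i => ZMod (D.m i)) s r i.succ).val)
      = ⇑D.tailHom ∘ fun i => D.tail.y i ^ (r i).val := by
    funext i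
    rw [Function.comp_apply, map_pow, tailHom_y]
    rfl
  rw [this]
  rfl

/-- The property passes to sums and products, so only the generators need checking: `b` is a twist
of `a`, and `c` records the linking relation. This is the rewriting step that moves y_0 to the left.
-/
theorem tailHom_mul_y (a : D.tail.H) :
    ∃ b c, D.tailHom a * D.y 0 = D.y 0 * D.tailHom b + D.tailHom c := by
  induction a using D.tail.induction_on with
  | hg h => exact ⟨(D.χ 0 h : k) • D.tail.grp h, 0, by simp [grp_mul_y]⟩
  | hx i =>
    refine ⟨(D.q i.succ 0 : k) • (D.tail.grp (D.g 0) * D.tail.x i * D.tail.grp (D.g 0)⁻¹),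
      D.lamLink i.succ 0 • ((1 - D.tail.grp (D.g i.succ * D.g 0)) * D.tail.grp (D.g 0)⁻¹), ?_⟩
    simp only [map_smul, map_mul, map_sub, map_one, tailHom_grp, tailHom_x]
    rw [y, ← mul_assoc, D.x_mul_x (Fin.succ_ne_zero i), add_mul, smul_mul_assoc, smul_mul_assoc,
      mul_smul_comm, ← map_mul]
    congr 2
    rw [mul_assoc (D.x 0) (D.grp _), ← mul_assoc (D.grp _), ← mul_assoc (D.grp _),
      grp_inv_mul_grp, one_mul, ← mul_assoc]
  | hadd a a' ha ha' =>
    obtain ⟨b, c, h⟩ := ha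
    obtain ⟨b', c', h'⟩ := ha'
    refine ⟨b + b', c + c', ?_⟩
    simp only [map_add, add_mul, h, h', mul_add]
    abel
  | hmul a a' ha ha' =>
    obtain ⟨b, c, h⟩ := ha
    obtain ⟨b', c', h'⟩ := ha'
    refine ⟨b * b', c * b' + a * c', ?_⟩
    rw [map_mul, mul_assoc, h', mul_add, ← mul_assoc, h]
    simp only [map_add, map_mul, add_mul, mul_assoc, add_assoc]
  | hsmul t a ha =>
    obtain ⟨b, c, h⟩ := ha
    refine ⟨t • b, t • c, ?_⟩
    rw [map_smul, smul_mul_assoc, h, smul_add, map_smul, map_smul, mul_smul_comm]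

variable [Finite G]

/-- The span contains 1 and is stable under right multiplication by each generator. -/
theorem span_y_pow_mul :
    Submodule.span k (Set.range fun p : ZMod (D.m 0) × D.tail.H =>
      D.y 0 ^ p.1.val * D.tailHom p.2) = ⊤ := by
  set S := Submodule.span k (Set.range fun p : ZMod (D.m 0) × D.tail.H =>
      D.y 0 ^ p.1.val * D.tailHom p.2) with hS
  have hmem : ∀ (r : ℕ) (_ : r < D.m 0) (a : D.tail.H), D.y 0 ^ r * D.tailHom a ∈ S := by
    intro r hr a
    refine Submodule.subset_span ⟨(r, a), ?_⟩
    simp only [ZMod.val_natCast, Nat.mod_eq_of_lt hr]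
  -- Right multiplication by y_0 can produce the exponent m_0. It folds back to the exponent 0,
  -- because y_0^(m_0) is a scalar multiple of x_0^(m_0) times a group element and therefore lies in
  -- the image of the smaller algebra.
  have hmem' : ∀ (r : ℕ) (_ : r ≤ D.m 0) (a : D.tail.H), D.y 0 ^ r * D.tailHom a ∈ S := by
    intro r hr a
    rcases hr.lt_or_eq with h | h
    · exact hmem r h a
    · obtain ⟨u, hu⟩ := D.y_pow 0 r
      have : D.y 0 ^ r * D.tailHom a = D.y 0 ^ 0 * D.tailHom ((u : k) •
          (D.lam 0 • (1 - D.tail.grp (D.g 0 ^ D.m 0))) * D.tail.grp ((D.g 0)⁻¹ ^ r) * a) := by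
        rw [hu, h]
        simp only [x_pow, map_smul, map_mul, map_sub, map_one, tailHom_grp, Units.smul_def,
          smul_mul_assoc, pow_zero, one_mul]
      rw [this]
      exact hmem 0 (D.m_pos 0) _
  have key : ∀ b : D.H, ∀ s ∈ S, s * b ∈ S := by
    have hA : ∀ a : D.tail.H, ∀ s ∈ S, s * D.tailHom a ∈ S := by
      intro a s hs
      induction hs using Submodule.span_induction with
      | mem s hs =>
        obtain ⟨p, rfl⟩ := hs
        simp only [mul_assoc, ← map_mul]
        exact hmem _ (ZMod.val_lt _) _
      | zero => simp
      | add s s' _ _ h h' => rw [add_mul]; exact S.add_mem h h'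
      | smul t s _ h => rw [smul_mul_assoc]; exact S.smul_mem t h
    have hY : ∀ s ∈ S, s * D.y 0 ∈ S := by
      intro s hs
      induction hs using Submodule.span_induction with
      | mem s hs =>
        obtain ⟨p, rfl⟩ := hs
        obtain ⟨b, c, h⟩ := D.tailHom_mul_y p.2
        simp only [mul_assoc, h, mul_add]
        rw [← mul_assoc, ← pow_succ]
        have := ZMod.val_lt p.1
        exact S.add_mem (hmem' _ (by omega) _) (hmem' _ (by omega) _)
      | zero => simp
      | add s s' _ _ h h' => rw [add_mul]; exact S.add_mem h h'
      | smul t s _ h => rw [smul_mul_assoc]; exact S.smul_mem t h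
    intro b
    induction b using D.induction_on with
    | hg h => simpa using hA (D.tail.grp h)
    | hx i =>
      refine Fin.cases ?_ (fun i => ?_) i
      · intro s hs
        rw [x_eq, ← mul_assoc]
        simpa using hA (D.tail.grp (D.g 0)) _ (hY s hs)
      · simpa using hA (D.tail.x i)
    | hadd a b ha hb => intro s hs; rw [mul_add]; exact S.add_mem (ha s hs) (hb s hs)
    | hmul a b ha hb => intro s hs; rw [← mul_assoc]; exact hb _ (ha s hs)
    | hsmul c a ha => intro s hs; rw [mul_smul_comm]; exact S.smul_mem c (ha s hs)
  rw [eq_top_iff]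
  intro b _
  have h1 : (1 : D.H) ∈ S := by simpa using hmem 0 (D.m_pos 0) 1
  simpa using key b 1 h1

end tail

theorem span_monomial {k G : Type*} [Field k] [CommGroup G] [Finite G] {n : ℕ}
    (D : LiftingDatum k G n) :
    Submodule.span k (Set.range fun p : (∀ i, ZMod (D.m i)) × G => D.monomial p.1 p.2) = ⊤ := by
  induction n with
  | zero =>
    set S := Submodule.span k
      (Set.range fun p : (∀ i, ZMod (D.m i)) × G => D.monomial p.1 p.2) with hS
    have hg : ∀ h, D.grp h ∈ S := fun h =>
      Submodule.subset_span ⟨(fun i => i.elim0, h), by simp [monomial]⟩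
    have hmul : ∀ b, ∀ s ∈ S, s * b ∈ S := by
      intro b
      induction b using D.induction_on with
      | hg h =>
        intro s hs
        induction hs using Submodule.span_induction with
        | mem s hs =>
          obtain ⟨p, rfl⟩ := hs
          rw [monomial_mul_grp]
          exact Submodule.subset_span ⟨(p.1, p.2 * h), rfl⟩
        | zero => simp
        | add s s' _ _ h h' => rw [add_mul]; exact S.add_mem h h'
        | smul t s _ h => rw [smul_mul_assoc]; exact S.smul_mem t h
      | hx i => exact i.elim0
      | hadd a b ha hb => intro s hs; rw [mul_add]; exact S.add_mem (ha s hs) (hb s hs)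
      | hmul a b ha hb => intro s hs; rw [← mul_assoc]; exact hb _ (ha s hs)
      | hsmul c a ha => intro s hs; rw [mul_smul_comm]; exact S.smul_mem c (ha s hs)
    rw [eq_top_iff]
    intro b _
    simpa using hmul b _ (hg 1)
  | succ n ih =>
    rw [eq_top_iff, ← D.span_y_pow_mul, Submodule.span_le]
    rintro _ ⟨⟨s, a⟩, rfl⟩
    have ha : a ∈ Submodule.span k
      (Set.range fun p : (∀ i, ZMod (D.tail.m i)) × G => D.tail.monomial p.1 p.2) := by
      rw [ih]; trivial
    simp only [SetLike.mem_coe]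
    induction ha using Submodule.span_induction with
    | mem a ha =>
      obtain ⟨p, rfl⟩ := ha
      rw [← monomial_cons]
      exact Submodule.subset_span ⟨(_, p.2), rfl⟩
    | zero => simp
    | add a b _ _ h h' => rw [map_add, mul_add]; exact Submodule.add_mem _ h h'
    | smul t a _ h => rw [map_smul, mul_smul_comm]; exact Submodule.smul_mem _ t h

instance finite_H {k G : Type*} [Field k] [CommGroup G] [Finite G] {n : ℕ}
    (D : LiftingDatum k G n) : Module.Finite k D.H := by
  refine ⟨⟨(Set.finite_range fun p : (∀ i, ZMod (D.m i)) × G => D.monomial p.1 p.2).toFinset, ?_⟩⟩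
  rw [Set.Finite.coe_toFinset, span_monomial]

end LiftingDatum

/-! ### Skew derivations and iterated skew commutators -/

/-- Moving `d` to the left turns the sum into a scalar times d P^(r-1). The scalar is the geometric
sum of `a` and `b * c`, which is annihilated by a - bc ≠ 0. -/
theorem sum_smul_pow_mul_mul_pow_eq_zero {k E : Type*} [Field k] [Ring E] [Algebra k E]
    {P d : E} {a b c : k} {r : ℕ} (h : P * d = c • (d * P)) (hr : a ^ r = (b * c) ^ r)
    (hne : a ≠ b * c) :
    ∑ s ∈ Finset.range r, (a ^ s * b ^ (r - 1 - s)) • (P ^ (r - 1 - s) * d * P ^ s) = 0 := by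
  have hP : ∀ s, P ^ s * d = c ^ s • (d * P ^ s) := by
    intro s
    induction s with
    | zero => simp
    | succ s ih =>
      rw [pow_succ', mul_assoc, ih, mul_smul_comm, ← mul_assoc, h, smul_mul_assoc, smul_smul,
        mul_assoc, ← pow_succ', ← pow_succ]
  have hs : ∀ s ∈ Finset.range r, (a ^ s * b ^ (r - 1 - s)) • (P ^ (r - 1 - s) * d * P ^ s)
      = (a ^ s * (b * c) ^ (r - 1 - s)) • (d * P ^ (r - 1)) := by
    intro s hs
    rw [Finset.mem_range] at hs
    rw [hP, smul_mul_assoc, smul_smul, mul_assoc d, ← pow_add, mul_pow, mul_assoc,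
      Nat.sub_add_cancel (by omega)]
  rw [Finset.sum_congr rfl hs, ← Finset.sum_smul]
  have h0 : (∑ s ∈ Finset.range r, a ^ s * (b * c) ^ (r - 1 - s)) * (a - b * c) = 0 := by
    rw [Commute.geom_sum₂_mul (Commute.all _ _), hr, sub_self]
  rw [(mul_eq_zero.mp h0).resolve_right (sub_ne_zero.mpr hne), zero_smul]

/-- The linking terms have the form l(1 - e); the geometric-sum argument is applied separately to 1
and to `e`. Conditions on the scalars are needed only when the linking parameter is nonzero. -/
theorem sum_smul_pow_mul_one_sub_mul_pow_eq_zero {k E : Type*} [Field k] [Ring E] [Algebra k E]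
    {P e : E} {a b c l : k} {r : ℕ} (h : P * e = c • (e * P))
    (hl : l ≠ 0 → a ^ r = b ^ r ∧ a ≠ b ∧ a ^ r = (b * c) ^ r ∧ a ≠ b * c) :
    ∑ s ∈ Finset.range r, (a ^ s * b ^ (r - 1 - s)) •
      (P ^ (r - 1 - s) * (l • (1 - e)) * P ^ s) = 0 := by
  by_cases h0 : l = 0
  · simp [h0]
  obtain ⟨h1, h2, h3, h4⟩ := hl h0
  have s1 := sum_smul_pow_mul_mul_pow_eq_zero (P := P) (d := 1) (a := a) (b := b) (c := 1) (r := r)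
    (by simp) (by simpa using h1) (by simpa using h2)
  have s2 := sum_smul_pow_mul_mul_pow_eq_zero (a := a) (b := b) h h3 h4
  calc _ = l • (∑ s ∈ Finset.range r, (a ^ s * b ^ (r - 1 - s)) • (P ^ (r - 1 - s) * 1 * P ^ s)
        - ∑ s ∈ Finset.range r, (a ^ s * b ^ (r - 1 - s)) • (P ^ (r - 1 - s) * e * P ^ s)) := by
        rw [← Finset.sum_sub_distrib, Finset.smul_sum]
        refine Finset.sum_congr rfl fun s _ => ?_
        rw [mul_smul_comm, smul_mul_assoc, smul_comm _ l, mul_sub, sub_mul, smul_sub]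
    _ = 0 := by rw [s1, s2, sub_zero, smul_zero]

theorem pow_mul_of_mul_eq {k E : Type*} [Field k] [Ring E] [Algebra k E]
    {P Y d : E} {q : k} (h : P * Y = q • (Y * P) + d) (r : ℕ) :
    P ^ r * Y = q ^ r • (Y * P ^ r)
      + ∑ s ∈ Finset.range r, q ^ s • (P ^ (r - 1 - s) * d * P ^ s) := by
  induction r with
  | zero => simp
  | succ r ih =>
    rw [pow_succ, mul_assoc, h, mul_add, mul_smul_comm, ← mul_assoc, ih, add_mul, smul_add,
      Finset.sum_range_succ', Finset.sum_mul, Finset.smul_sum, add_assoc]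
    congr 1
    · rw [smul_mul_assoc, smul_smul, mul_assoc, ← pow_succ, ← pow_succ']
    · congr 1
      · refine Finset.sum_congr rfl fun s _ => ?_
        rw [smul_mul_assoc, smul_smul, mul_assoc, ← pow_succ, ← pow_succ',
          show r + 1 - 1 - (s + 1) = r - 1 - s by omega]
      · simp

theorem upperTriangular_pow {E : Type*} [Ring E] (a d b : E) (r : ℕ) :
    (!![a, d; 0, b] : Matrix (Fin 2) (Fin 2) E) ^ r
      = !![a ^ r, ∑ s ∈ Finset.range r, a ^ (r - 1 - s) * d * b ^ s; 0, b ^ r] := by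
  induction r with
  | zero => simp [Matrix.one_fin_two]
  | succ r ih =>
    rw [pow_succ, ih, Matrix.mul_fin_two, Finset.sum_range_succ']
    have : ∀ s ∈ Finset.range r, a ^ (r - 1 - s) * d * b ^ s * b
        = a ^ (r + 1 - 1 - (s + 1)) * d * b ^ (s + 1) := by
      intro s _
      rw [mul_assoc, ← pow_succ, show r + 1 - 1 - (s + 1) = r - 1 - s by omega]
    rw [Finset.sum_mul (a := b), Finset.sum_congr rfl this]
    simp [pow_succ, add_comm]

/-! ### The module of truncated skew polynomials -/

/-- `δ` is a left `σ`-derivation, for the algebra endomorphism `σ`. -/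
structure IsSkewDerivation {k A : Type*} [Field k] [Ring A] [Algebra k A]
    (σ δ : A →ₗ[k] A) : Prop where
  map_one : σ 1 = 1
  map_mul : ∀ a b, σ (a * b) = σ a * σ b
  der_one : δ 1 = 0
  der_mul : ∀ a b, δ (a * b) = σ a * δ b + δ a * b

section skewShift

variable {k A : Type*} [Field k] [Ring A] [Algebra k A] (σ δ : A →ₗ[k] A) (c : A) (m : ℕ)

/-- Left multiplication by the variable `X` on the free left `A`-module with basis
`1, X, …, X ^ (m - 1)`, where `X a = σ(a) X + δ(a)` and `X ^ m = c`. -/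
def skewShift : Module.End k (ZMod m → A) where
  toFun v r := δ (v r) + σ (v (r - 1)) * (if r = 0 then c else 1)
  map_add' v w := by
    funext r
    simp only [Pi.add_apply, map_add, add_mul]
    abel
  map_smul' t v := by
    funext r
    simp only [Pi.smul_apply, map_smul, smul_mul_assoc, smul_add, RingHom.id_apply]

/-- Right multiplication by the variable on the same module. -/
def skewShiftRight : Module.End k (ZMod m → A) where
  toFun v r := v (r - 1) * (if r = 0 then c else 1)
  map_add' v w := by
    funext r
    simp only [Pi.add_apply, add_mul]
  map_smul' t v := by
    funext r
    simp only [Pi.smul_apply, smul_mul_assoc, RingHom.id_apply]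

variable {σ δ c m}

theorem skewShift_apply (v : ZMod m → A) (r : ZMod m) :
    skewShift σ δ c m v r = δ (v r) + σ (v (r - 1)) * (if r = 0 then c else 1) := rfl

theorem skewShiftRight_apply (v : ZMod m → A) (r : ZMod m) :
    skewShiftRight (k := k) c m v r = v (r - 1) * (if r = 0 then c else 1) := rfl

theorem skewShift_mul_lsmul (hd : IsSkewDerivation σ δ) (a : A) :
    skewShift σ δ c m * Algebra.lsmul k k (ZMod m → A) a
      = Algebra.lsmul k k (ZMod m → A) (σ a) * skewShift σ δ c m
        + Algebra.lsmul k k (ZMod m → A) (δ a) := by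
  ext1 v
  funext r
  simp only [Module.End.mul_apply, LinearMap.add_apply, Algebra.lsmul_coe, skewShift_apply,
    Pi.add_apply, Pi.smul_apply, smul_eq_mul, hd.map_mul, hd.der_mul, mul_add, mul_assoc]
  abel

/-- Expanding X^r a produces q^r a X^r plus a sum of derivation terms, and that sum vanishes by the
geometric-sum lemma. -/
theorem skewShift_pow_smul (hd : IsSkewDerivation σ δ) {a e : A} {q t l : k} {r : ℕ}
    (ha : σ a = q • a) (hda : δ a = l • (1 - e)) (he : σ e = t • e) (hde : δ e = 0)
    (hl : l ≠ 0 → q ^ r = 1 ∧ q ≠ 1 ∧ q ^ r = t ^ r ∧ q ≠ t) (v : ZMod m → A) :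
    (skewShift σ δ c m ^ r) (a • v) = q ^ r • a • (skewShift σ δ c m ^ r) v := by
  have h1 := skewShift_mul_lsmul (c := c) (m := m) hd a
  rw [ha, map_smul, smul_mul_assoc] at h1
  have h2 := skewShift_mul_lsmul (c := c) (m := m) hd e
  rw [he, hde, map_zero, add_zero, map_smul, smul_mul_assoc] at h2
  have h3 := pow_mul_of_mul_eq (k := k) (E := Module.End k (ZMod m → A)) h1 r
  rw [hda, map_smul, map_sub, map_one] at h3
  have h4 := sum_smul_pow_mul_one_sub_mul_pow_eq_zero (E := Module.End k (ZMod m → A))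
    (l := l) (a := q) (b := 1) (r := r) h2
    (by simpa using hl)
  simp only [one_pow, mul_one] at h4
  rw [h4, add_zero] at h3
  exact LinearMap.congr_fun h3 v

/-- Left and right multiplication by X commute; the wrap-around X^m = c is compatible with this
because σ fixes `c` and δ kills it. -/
theorem skewShift_commute_right (hd : IsSkewDerivation σ δ) (hσc : σ c = c)
    (hδc : δ c = 0) :
    Commute (skewShift σ δ c m) (skewShiftRight (k := k) c m) := by
  have h1 : ∀ r : ZMod m, σ (if r = 0 then c else 1) = if r = 0 then c else 1 := by
    intro r; split_ifs; exacts [hσc, hd.map_one]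
  have h2 : ∀ r : ZMod m, δ (if r = 0 then c else 1) = 0 := by
    intro r; split_ifs; exacts [hδc, hd.der_one]
  refine LinearMap.ext fun v => funext fun r => ?_
  simp only [Module.End.mul_apply, skewShift_apply, skewShiftRight_apply, hd.der_mul, hd.map_mul,
    h1, h2, mul_zero, zero_add, add_mul]

theorem skewShift_single (hd : IsSkewDerivation σ δ) [NeZero m] (s : ℕ) (hs : s + 1 < m) :
    skewShift σ δ c m (Pi.single (s : ZMod m) 1) = Pi.single ((s + 1 : ℕ) : ZMod m) 1 := by
  have hs0 : ((s + 1 : ℕ) : ZMod m) ≠ 0 := by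
    rw [Ne, ZMod.natCast_eq_zero_iff]
    exact fun h => absurd (Nat.le_of_dvd (by omega) h) (by omega)
  funext r
  rw [skewShift_apply]
  have h1 : δ ((Pi.single (s : ZMod m) (1 : A) : ZMod m → A) r) = 0 := by
    rw [Pi.single_apply]; split_ifs <;> simp [hd.der_one]
  rw [h1, zero_add, Pi.single_apply, Pi.single_apply]
  by_cases h : r = ((s + 1 : ℕ) : ZMod m)
  · subst h
    rw [if_pos (by push_cast; ring), if_neg hs0, if_pos rfl, hd.map_one, mul_one]
  · rw [if_neg (fun h' => h (by push_cast; rw [← h']; ring)), if_neg h, map_zero, zero_mul]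

theorem skewShift_pow_single (hd : IsSkewDerivation σ δ) [NeZero m] (s : ℕ) (hs : s < m) :
    (skewShift σ δ c m ^ s) (Pi.single 0 1) = Pi.single (s : ZMod m) 1 := by
  induction s with
  | zero => simp
  | succ s ih =>
    rw [pow_succ', Module.End.mul_apply, ih (by omega), skewShift_single hd s hs]

theorem skewShift_pow_m_single (hd : IsSkewDerivation σ δ) [NeZero m] :
    (skewShift σ δ c m ^ m) (Pi.single 0 1) = Pi.single 0 c := by
  obtain ⟨p, hp⟩ : ∃ p, m = p + 1 := ⟨m - 1, by have := NeZero.pos m; omega⟩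
  have hp' : (skewShift σ δ c m ^ m) (Pi.single 0 1)
      = skewShift σ δ c m ((skewShift σ δ c m ^ p) (Pi.single 0 1)) := by
    rw [← Module.End.mul_apply, ← pow_succ', ← hp]
  rw [hp', skewShift_pow_single hd p (by omega)]
  have hp0 : (p : ZMod m) = -1 := by
    rw [eq_neg_iff_add_eq_zero]
    exact_mod_cast (by rw [← hp]; exact ZMod.natCast_self m : ((p + 1 : ℕ) : ZMod m) = 0)
  funext r
  rw [skewShift_apply]
  have h1 : δ ((Pi.single (p : ZMod m) (1 : A) : ZMod m → A) r) = 0 := by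
    rw [Pi.single_apply]; split_ifs <;> simp [hd.der_one]
  rw [h1, zero_add, Pi.single_apply, Pi.single_apply, hp0]
  by_cases h : r = 0
  · subst h
    simp [hd.map_one]
  · rw [if_neg (fun h' => h (by simpa using h')), if_neg h, map_zero, zero_mul,
      if_neg h]

theorem skewShiftRight_pow_single [NeZero m] (s : ℕ) (hs : s < m) :
    (skewShiftRight (k := k) c m ^ s) (Pi.single 0 1) = Pi.single (s : ZMod m) 1 := by
  -- Right multiplication by X is the special case of the left shift with trivial twist and zero
  -- derivation.
  have h := skewShift_pow_single (σ := LinearMap.id) (δ := (0 : A →ₗ[k] A)) (c := c) (m := m)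
    ⟨by simp, by simp, by simp, by simp⟩ s hs
  convert h using 3
  refine LinearMap.ext fun v => funext fun r => ?_
  simp [skewShift_apply, skewShiftRight_apply]

/-- `X ^ m = c` holds as soon as the elements preserving this relation exhaust `A`. -/
theorem skewShift_pow (hd : IsSkewDerivation σ δ) [NeZero m] (hσc : σ c = c) (hδc : δ c = 0)
    (hA : ∀ a : A, ∀ v, (skewShift σ δ c m ^ m) v = c • v →
      (skewShift σ δ c m ^ m) (a • v) = c • a • v) :
    skewShift σ δ c m ^ m = Algebra.lsmul k k (ZMod m → A) c := by
  -- The relation X^m = c is known on the first basis vector. Right multiplication by X commutes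
  -- with both sides and carries it to every basis vector X^s.
  have hR : ∀ s : ℕ, s < m → (skewShift σ δ c m ^ m) (Pi.single (s : ZMod m) 1)
      = c • Pi.single (s : ZMod m) 1 := by
    intro s hs
    have hcomm : Commute (skewShift σ δ c m ^ m) (skewShiftRight (k := k) c m ^ s) :=
      (skewShift_commute_right hd hσc hδc).pow_pow _ _
    have hl : Commute (Algebra.lsmul k k (ZMod m → A) c) (skewShiftRight (k := k) c m) := by
      refine LinearMap.ext fun v => funext fun r => ?_
      simp [skewShiftRight_apply, mul_assoc]
    have e0 : (Pi.single 0 c : ZMod m → A) = Algebra.lsmul k k (ZMod m → A) c (Pi.single 0 1) := by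
      simp [← Pi.single_smul]
    rw [← skewShiftRight_pow_single (k := k) (c := c) s hs, ← Module.End.mul_apply, hcomm.eq,
      Module.End.mul_apply, skewShift_pow_m_single hd, e0, ← Module.End.mul_apply,
      ← (hl.pow_right s).eq, Module.End.mul_apply, Algebra.lsmul_coe]
  refine LinearMap.ext fun v => ?_
  have hv : v = ∑ r : ZMod m, v r • (Pi.single r 1 : ZMod m → A) := by
    conv_lhs => rw [← Finset.univ_sum_single v]
    refine Finset.sum_congr rfl fun r _ => ?_
    rw [← Pi.single_smul, smul_eq_mul, mul_one]
  rw [hv, map_sum, map_sum]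
  refine Finset.sum_congr rfl fun r _ => ?_
  rw [Algebra.lsmul_coe]
  refine hA _ _ ?_
  have := hR r.val (ZMod.val_lt r)
  rwa [ZMod.natCast_zmod_val] at this

end skewShift

/-! ### Constraints on the characters forced by nonzero parameters -/

namespace LiftingDatum

section scalars

variable {k G : Type*} [Field k] [CommGroup G] {n : ℕ} (D : LiftingDatum k G n)

theorem χ_mul_χ_eq_one {a b : Fin n} (hab : a ≠ b) (h : D.lamLink a b ≠ 0) (t : G) :
    D.χ a t * D.χ b t = 1 := by
  have := (mul_eq_zero.mp (D.lamLink_mul a b hab t)).resolve_left h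
  ext
  simpa [sub_eq_zero] using this

/-- The braiding condition turns χ_i(g_a g_b) into the inverse of (χ_a χ_b)(g_i), and χ_a χ_b is
trivial once λ_ab ≠ 0. -/
theorem χ_g_mul_g_eq_one {a b i : Fin n} (hab : a ≠ b) (h : D.lamLink a b ≠ 0) (hia : i ≠ a)
    (hib : i ≠ b) : D.χ i (D.g a * D.g b) = 1 := by
  have h1 := D.χ_mul_χ i a hia
  have h2 := D.χ_mul_χ i b hib
  have h3 := D.χ_mul_χ_eq_one hab h (D.g i)
  rw [map_mul, eq_inv_of_mul_eq_one_left h1, eq_inv_of_mul_eq_one_left h2, ← mul_inv, h3, inv_one]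

theorem χ_pow_m_eq_one {i : Fin n} (h : D.lam i ≠ 0) (t : G) : D.χ i t ^ D.m i = 1 := by
  have := (mul_eq_zero.mp (D.lam_mul i t)).resolve_left h
  ext
  simpa [sub_eq_zero, m, q] using this

theorem χ_self_pow_m (i : Fin n) : D.χ i (D.g i) ^ D.m i = 1 := pow_orderOf_eq_one _

/-- Both values are inverse to χ_b(g_a), one by the braiding condition and the other by χ_a χ_b = 1.
Hence mixed braiding scalars of linked indices inherit their order from the diagonal ones. -/
theorem χ_g_right {a b : Fin n} (hab : a ≠ b) (h : D.lamLink a b ≠ 0) :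
    D.χ a (D.g b) = D.χ a (D.g a) := by
  have h1 := D.χ_mul_χ a b hab
  have h3 := D.χ_mul_χ_eq_one hab h (D.g a)
  rw [eq_inv_of_mul_eq_one_left h1, eq_inv_of_mul_eq_one_left h3]

theorem χ_g_left {a b : Fin n} (hab : a ≠ b) (h : D.lamLink a b ≠ 0) :
    D.χ b (D.g a) = D.χ b (D.g b) := by
  have h1 := D.χ_mul_χ a b hab
  have h3 := D.χ_mul_χ_eq_one hab h (D.g b)
  rw [eq_inv_of_mul_eq_one_right h1, eq_inv_of_mul_eq_one_right h3]

end scalars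

/-! ### Adjoining the first generator to the smaller algebra -/

section skew

variable {k G : Type*} [Field k] [CommGroup G] {n : ℕ} (D : LiftingDatum k G (n + 1))

/-- The group part of `skewMat`. -/
noncomputable def skewMatGrp : G →* Matrix (Fin 2) (Fin 2) D.tail.H where
  toFun h := !![(((D.χ 0 h)⁻¹ : kˣ) : k) • D.tail.grp h, 0; 0, D.tail.grp h]
  map_one' := by simp [Matrix.one_fin_two]
  map_mul' a b := by
    rw [Matrix.mul_fin_two]
    simp [smul_smul, mul_comm]

theorem skewMatGrp_apply (h : G) : D.skewMatGrp h
    = !![(((D.χ 0 h)⁻¹ : kˣ) : k) • D.tail.grp h, 0; 0, D.tail.grp h] := rfl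

/-- The images of the `x_j` under `skewMat`. -/
noncomputable def skewMatX (j : Fin n) : Matrix (Fin 2) (Fin 2) D.tail.H :=
  !![(D.q 0 j.succ : k) • D.tail.x j,
    D.lamLink 0 j.succ • (1 - D.tail.grp (D.g 0 * D.g j.succ)); 0, D.tail.x j]

theorem skewMat_comm (h : G) (i : Fin n) : D.skewMatGrp h * D.skewMatX i
    = (D.tail.χ i h : k) • (D.skewMatX i * D.skewMatGrp h) := by
  -- The off-diagonal entry matches because χ_0⁻¹ = χ_i whenever λ_0i ≠ 0.
  have e : D.lamLink 0 i.succ * (((D.χ 0 h)⁻¹ : kˣ) : k) = D.lamLink 0 i.succ * D.χ i.succ h := by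
    by_cases h0 : D.lamLink 0 i.succ = 0
    · simp [h0]
    · rw [← eq_inv_of_mul_eq_one_right (D.χ_mul_χ_eq_one (Fin.succ_ne_zero i).symm h0 h)]
  rw [skewMatGrp_apply, skewMatX, Matrix.mul_fin_two, Matrix.mul_fin_two]
  ext a b
  fin_cases a <;> fin_cases b
  · simp [grp_mul_x, smul_smul]
    ring_nf
  · simp only [Matrix.smul_apply]
    simp [mul_sub, sub_mul, ← map_mul, mul_comm h, smul_smul]
    rw [Units.val_inv_eq_inv_val] at e
    rw [← smul_sub, smul_smul, e, mul_comm]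
  · simp
  · simp [grp_mul_x]

/-- The upper row holds by the scalar identities below. Each is trivial if the linking parameter in
it vanishes, and otherwise follows from the triviality of the product of the two linked characters.
-/
theorem skewMat_link (i j : Fin n) (hij : i ≠ j) : D.skewMatX i * D.skewMatX j
    = (D.tail.q i j : k) • (D.skewMatX j * D.skewMatX i)
      + D.tail.lamLink i j • (1 - D.skewMatGrp (D.tail.g i * D.tail.g j)) := by
  have hij' : i.succ ≠ j.succ := by simpa using hij
  have hq : D.tail.q i j = D.q i.succ j.succ := rfl
  have e0 : D.lamLink i.succ j.succ * ((D.q 0 i.succ : k) * D.q 0 j.succ)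
      = D.lamLink i.succ j.succ := by
    by_cases h0 : D.lamLink i.succ j.succ = 0
    · simp [h0]
    · rw [← Units.val_mul, q, q, D.χ_mul_χ_eq_one hij' h0]; simp
  have e1 : D.lamLink i.succ j.succ * (((D.χ 0 (D.g i.succ * D.g j.succ))⁻¹ : kˣ) : k)
      = D.lamLink i.succ j.succ := by
    by_cases h0 : D.lamLink i.succ j.succ = 0
    · simp [h0]
    · rw [D.χ_g_mul_g_eq_one hij' h0 (Fin.succ_ne_zero i).symm (Fin.succ_ne_zero j).symm]; simp
  have e2 : D.lamLink 0 j.succ * (D.q i.succ j.succ : k) = D.lamLink 0 j.succ * D.q 0 i.succ := by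
    by_cases h0 : D.lamLink 0 j.succ = 0
    · simp [h0]
    · have h1 := D.χ_mul_χ_eq_one (Fin.succ_ne_zero j).symm h0 (D.g i.succ)
      have h2 := D.χ_mul_χ 0 i.succ (Fin.succ_ne_zero i).symm
      rw [q, q, eq_inv_of_mul_eq_one_right h1, eq_inv_of_mul_eq_one_right h2]
  have e3 : D.lamLink 0 j.succ * (D.χ i.succ (D.g 0 * D.g j.succ) : k) = D.lamLink 0 j.succ := by
    by_cases h0 : D.lamLink 0 j.succ = 0
    · simp [h0]
    · rw [D.χ_g_mul_g_eq_one (Fin.succ_ne_zero j).symm h0 (Fin.succ_ne_zero i) hij']; simp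
  have e4 : D.lamLink 0 i.succ * (D.χ j.succ (D.g 0 * D.g i.succ) : k) = D.lamLink 0 i.succ := by
    by_cases h0 : D.lamLink 0 i.succ = 0
    · simp [h0]
    · rw [D.χ_g_mul_g_eq_one (Fin.succ_ne_zero i).symm h0 (Fin.succ_ne_zero j) hij'.symm]; simp
  have e5 : (D.χ j.succ (D.g 0 * D.g i.succ) : k) = D.q 0 j.succ * D.q i.succ j.succ := by
    rw [map_mul, Units.val_mul]; rfl
  rw [skewMatX, skewMatX, skewMatGrp_apply, Matrix.mul_fin_two, Matrix.mul_fin_two,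
    Matrix.one_fin_two]
  ext a b
  fin_cases a <;> fin_cases b
  · simp only [Matrix.smul_apply, Matrix.add_apply, Matrix.sub_apply]
    simp only [tail_g, tail_lamLink, Matrix.of_apply, Matrix.cons_val', Matrix.cons_val_zero,
      Fin.zero_eta, hq, smul_mul_assoc, mul_smul_comm, mul_zero, D.tail.x_mul_x hij,
      add_zero, smul_sub, smul_add, smul_smul, Matrix.cons_val_fin_one]
    linear_combination (norm := module) e0 • (1 - D.tail.grp (D.g i.succ * D.g j.succ))
      + e1 • (D.tail.grp (D.g i.succ * D.g j.succ))
  · simp only [Matrix.smul_apply, Matrix.add_apply, Matrix.sub_apply]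
    simp only [tail_g, Matrix.of_apply, Matrix.cons_val', Matrix.cons_val_zero, Matrix.cons_val_one,
      Fin.zero_eta, Fin.mk_one, hq, smul_mul_assoc, mul_smul_comm, mul_sub, sub_mul, mul_one,
      one_mul, grp_mul_x, tail_χ, sub_zero, smul_zero, add_zero, smul_sub, smul_add, smul_smul,
      Matrix.cons_val_fin_one]
    linear_combination (norm := skip) (-e2) • D.tail.x i
      + (e2 * D.χ i.succ (D.g 0 * D.g j.succ)) • (D.tail.x i * D.tail.grp (D.g 0 * D.g j.succ))
      + ((D.q 0 i.succ : k) * e3) • (D.tail.x i * D.tail.grp (D.g 0 * D.g j.succ))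
      - e4 • D.tail.x j
    rw [e5]
    module
  · simp
  · simp only [Matrix.smul_apply, Matrix.add_apply, Matrix.sub_apply]
    simp [D.tail.x_mul_x hij]

theorem x_mul_grp {n : ℕ} (D : LiftingDatum k G n) (h : G) (i : Fin n) :
    D.x i * D.grp h = (((D.χ i h)⁻¹ : kˣ) : k) • (D.grp h * D.x i) := by
  rw [grp_mul_x, smul_smul, Units.inv_mul, one_smul]

/-- Left multiplications on the module of truncated skew polynomials in `x_0`. -/
noncomputable def lmul : D.tail.H →ₐ[k] Module.End k (ZMod (D.m 0) → D.tail.H) :=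
  Algebra.lsmul k k (ZMod (D.m 0) → D.tail.H)

theorem lmul_apply (a : D.tail.H) (v : ZMod (D.m 0) → D.tail.H) : D.lmul a v = a • v := rfl

/-- The off-diagonal entry of the power is a sum of the linking terms. If λ_0j ≠ 0 then q_0j = q_jj,
a root of unity of order m_j > 1, and the geometric sums vanish. -/
theorem skewMat_pow (j : Fin n) : D.skewMatX j ^ D.tail.m j
    = D.tail.lam j • (1 - D.skewMatGrp (D.tail.g j ^ D.tail.m j)) := by
  have hm : D.tail.m j = D.m j.succ := rfl
  have h0j : D.χ 0 (D.g j.succ) * D.q 0 j.succ = 1 := D.χ_mul_χ 0 j.succ (Fin.succ_ne_zero j).symm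
  have e0 : D.lam j.succ * (D.q 0 j.succ : k) ^ D.m j.succ = D.lam j.succ := by
    by_cases h0 : D.lam j.succ = 0
    · simp [h0]
    · rw [← Units.val_pow_eq_pow_val, q, D.χ_pow_m_eq_one h0]; simp
  have e1 : (((D.χ 0 (D.g j.succ ^ D.m j.succ))⁻¹ : kˣ) : k) = (D.q 0 j.succ : k) ^ D.m j.succ := by
    rw [map_pow, eq_inv_of_mul_eq_one_left h0j, inv_pow, inv_inv, Units.val_pow_eq_pow_val]
  have hsum : ∑ s ∈ Finset.range (D.m j.succ), ((D.q 0 j.succ : k) • D.tail.x j)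
      ^ (D.m j.succ - 1 - s) * (D.lamLink 0 j.succ • (1 - D.tail.grp (D.g 0 * D.g j.succ)))
        * D.tail.x j ^ s = 0 := by
    have := sum_smul_pow_mul_one_sub_mul_pow_eq_zero (l := D.lamLink 0 j.succ) (a := (1 : k))
      (b := D.q 0 j.succ) (r := D.m j.succ) (D.tail.x_mul_grp (D.g 0 * D.g j.succ) j) (by
        intro h0
        -- With q = q_jj the scalars are a = 1, b = q and c = q⁻², so both comparisons a ≠ b and a ≠
        -- bc reduce to q ≠ 1.
        have hq : D.q 0 j.succ = D.χ j.succ (D.g j.succ) :=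
          D.χ_g_left (Fin.succ_ne_zero j).symm h0
        have hc : D.χ j.succ (D.g 0 * D.g j.succ) = D.q 0 j.succ * D.q 0 j.succ := by
          rw [map_mul, ← hq]; rfl
        have hq1 : (D.q 0 j.succ : k) ≠ 1 := by
          rw [hq]
          exact fun h => D.χ_self_ne_one j.succ (Units.ext h)
        have hqm : (D.q 0 j.succ : k) ^ D.m j.succ = 1 := by
          rw [hq, ← Units.val_pow_eq_pow_val, D.χ_self_pow_m, Units.val_one]
        rw [tail_χ, hc]
        refine ⟨by simp [hqm], hq1.symm, by simp [hqm], by simpa using hq1⟩)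
    simpa only [one_pow, one_mul, smul_pow, smul_mul_assoc] using this
  rw [skewMatX, upperTriangular_pow, hm, hsum, smul_pow, ← hm, x_pow, skewMatGrp_apply,
    Matrix.one_fin_two, hm, tail_g, tail_lam, e1]
  ext a b
  fin_cases a <;> fin_cases b
  · simp only [Matrix.smul_apply, Matrix.sub_apply, Matrix.of_apply, Matrix.cons_val',
      Matrix.cons_val_zero, Fin.zero_eta, Matrix.cons_val_fin_one, smul_sub, smul_smul]
    rw [mul_comm, e0]
  · simp
  · simp
  · simp

/-- The algebra map `a ↦ [[σ a, δ a], [0, a]]`, which encodes the commutation of `x_0` with the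
subalgebra generated by the other generators: `x_0 a = σ(a) x_0 + δ(a)`. -/
noncomputable def skewMat : D.tail.H →ₐ[k] Matrix (Fin 2) (Fin 2) D.tail.H :=
  D.tail.lift D.skewMatGrp D.skewMatX D.skewMat_comm D.skewMat_link D.skewMat_pow

theorem skewMat_grp (h : G) : D.skewMat (D.tail.grp h) = D.skewMatGrp h :=
  D.tail.lift_grp _ _ _ _ _ h

theorem skewMat_x (j : Fin n) : D.skewMat (D.tail.x j) = D.skewMatX j :=
  D.tail.lift_x _ _ _ _ _ j

theorem skewMat_lower (a : D.tail.H) : D.skewMat a 1 0 = 0 ∧ D.skewMat a 1 1 = a := by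
  induction a using D.tail.induction_on with
  | hg h => simp [skewMat_grp, skewMatGrp_apply]
  | hx i => simp [skewMat_x, skewMatX]
  | hadd a b ha hb => simp [ha, hb]
  | hmul a b ha hb => simp [Matrix.mul_apply, Fin.sum_univ_two, ha, hb]
  | hsmul c a ha => simp [ha]

/-- The twist of `x_0`. -/
noncomputable def twist : D.tail.H →ₗ[k] D.tail.H :=
  Matrix.entryLinearMap k D.tail.H 0 0 ∘ₗ D.skewMat.toLinearMap

/-- The skew derivation of `x_0`. -/
noncomputable def skewDer : D.tail.H →ₗ[k] D.tail.H :=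
  Matrix.entryLinearMap k D.tail.H 0 1 ∘ₗ D.skewMat.toLinearMap

theorem twist_apply (a : D.tail.H) : D.twist a = D.skewMat a 0 0 := rfl

theorem skewDer_apply (a : D.tail.H) : D.skewDer a = D.skewMat a 0 1 := rfl

theorem isSkewDerivation : IsSkewDerivation D.twist D.skewDer where
  map_one := by simp [twist_apply]
  map_mul a b := by
    simp [twist_apply, Matrix.mul_apply, Fin.sum_univ_two, (D.skewMat_lower b).1]
  der_one := by simp [skewDer_apply]
  der_mul a b := by
    simp [twist_apply, skewDer_apply, Matrix.mul_apply, Fin.sum_univ_two, (D.skewMat_lower b).2]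

theorem twist_grp (h : G) :
    D.twist (D.tail.grp h) = (((D.χ 0 h)⁻¹ : kˣ) : k) • D.tail.grp h := by
  simp [twist_apply, skewMat_grp, skewMatGrp_apply]

theorem skewDer_grp (h : G) : D.skewDer (D.tail.grp h) = 0 := by
  simp [skewDer_apply, skewMat_grp, skewMatGrp_apply]

theorem twist_x (j : Fin n) : D.twist (D.tail.x j) = (D.q 0 j.succ : k) • D.tail.x j := by
  simp [twist_apply, skewMat_x, skewMatX]

theorem skewDer_x (j : Fin n) : D.skewDer (D.tail.x j)
    = D.lamLink 0 j.succ • (1 - D.tail.grp (D.g 0 * D.g j.succ)) := by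
  simp [skewDer_apply, skewMat_x, skewMatX]

/-- The value of `x_0 ^ m_0`. -/
noncomputable def powValue : D.tail.H := D.lam 0 • (1 - D.tail.grp (D.g 0 ^ D.m 0))

/-- The action of `x_0` on the module of truncated skew polynomials. -/
noncomputable def shift : Module.End k (ZMod (D.m 0) → D.tail.H) :=
  skewShift D.twist D.skewDer D.powValue (D.m 0)

theorem shift_mul_grp (h : G) :
    D.shift * D.lmul (D.tail.grp h)
      = (((D.χ 0 h)⁻¹ : kˣ) : k) •
        (D.lmul (D.tail.grp h) * D.shift) := by
  rw [shift, lmul, skewShift_mul_lsmul D.isSkewDerivation, twist_grp, skewDer_grp, map_zero,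
    add_zero, map_smul, smul_mul_assoc]

theorem shift_mul_x (j : Fin n) :
    D.shift * D.lmul (D.tail.x j)
      = (D.q 0 j.succ : k) •
        (D.lmul (D.tail.x j) * D.shift)
        + D.lamLink 0 j.succ • (1 - D.lmul
          (D.tail.grp (D.g 0 * D.g j.succ))) := by
  rw [shift, lmul, skewShift_mul_lsmul D.isSkewDerivation, twist_x, skewDer_x, map_smul,
    smul_mul_assoc, map_smul, map_sub, map_one]

theorem shift_pow_grp_smul (h : G) (r : ℕ) (v : ZMod (D.m 0) → D.tail.H) :
    (D.shift ^ r) (D.tail.grp h • v)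
      = (((D.χ 0 h)⁻¹ : kˣ) : k) ^ r • D.tail.grp h • (D.shift ^ r) v :=
  skewShift_pow_smul (e := 1) (t := 1) (l := 0) D.isSkewDerivation (D.twist_grp h)
    (by rw [skewDer_grp, zero_smul]) (by rw [D.isSkewDerivation.map_one, one_smul])
    D.isSkewDerivation.der_one (fun h => absurd rfl h) v

/-- If x_0 and x_j are linked, then q_0j = q_00⁻¹ has order m_0 and the twist scalar of g_0 g_j is
q_0j², so the derivation terms cancel exactly at the exponent m_0. -/
theorem shift_pow_x_smul (j : Fin n) (v : ZMod (D.m 0) → D.tail.H) :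
    (D.shift ^ D.m 0) (D.tail.x j • v)
      = (D.q 0 j.succ : k) ^ D.m 0 • D.tail.x j • (D.shift ^ D.m 0) v := by
  refine skewShift_pow_smul D.isSkewDerivation (D.twist_x j) (D.skewDer_x j) (D.twist_grp _)
    (D.skewDer_grp _) ?_ v
  intro h0
  have hq : D.q 0 j.succ = (D.χ 0 (D.g 0))⁻¹ :=
    eq_inv_of_mul_eq_one_right (D.χ_mul_χ_eq_one (Fin.succ_ne_zero j).symm h0 (D.g 0))
  have hc : (D.χ 0 (D.g 0 * D.g j.succ))⁻¹ = D.q 0 j.succ * D.q 0 j.succ := by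
    rw [map_mul, D.χ_g_right (Fin.succ_ne_zero j).symm h0, mul_inv, ← hq]
  have hq1 : (D.q 0 j.succ : k) ≠ 1 := by
    rw [hq]
    exact fun h => D.χ_self_ne_one 0 (inv_eq_one.mp (Units.ext h))
  have hqm : (D.q 0 j.succ : k) ^ D.m 0 = 1 := by
    rw [hq, ← Units.val_pow_eq_pow_val, inv_pow, D.χ_self_pow_m, inv_one, Units.val_one]
  rw [hc]
  refine ⟨hqm, hq1, by simp [mul_pow, hqm], by simpa using hq1⟩

variable [Finite G]

/-- The elements of A preserving X^m = c are closed under sums, products and scalars, so generators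
suffice. Moving a generator past X^(m_0) or past the value of that power costs an m_0-th power of a
value of χ_0, up to inversion, which is 1 when λ_0 ≠ 0. -/
theorem shift_pow :
    D.shift ^ D.m 0 = D.lam 0 • (1 - D.lmul
      (D.tail.grp (D.g 0 ^ D.m 0))) := by
  have hχ : ∀ h, D.lam 0 * (((D.χ 0 h)⁻¹ : kˣ) : k) ^ D.m 0 = D.lam 0 := by
    intro h
    by_cases h0 : D.lam 0 = 0
    · simp [h0]
    · rw [← Units.val_pow_eq_pow_val, inv_pow, D.χ_pow_m_eq_one h0]; simp
  have hq : ∀ j : Fin n, D.q 0 j.succ = (D.χ 0 (D.g j.succ))⁻¹ := fun j =>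
    eq_inv_of_mul_eq_one_right (D.χ_mul_χ 0 j.succ (Fin.succ_ne_zero j).symm)
  have key := skewShift_pow (m := D.m 0) (c := D.powValue) D.isSkewDerivation
    (by
      rw [powValue, map_smul, map_sub, D.isSkewDerivation.map_one, twist_grp, map_pow,
        D.χ_self_pow_m, inv_one, Units.val_one, one_smul])
    (by rw [powValue, map_smul, map_sub, D.isSkewDerivation.der_one, skewDer_grp, sub_zero,
        smul_zero])
    (by
      intro a
      induction a using D.tail.induction_on with
      | hg h =>
        intro v hv
        have := D.shift_pow_grp_smul h (D.m 0) v
        rw [shift, hv] at this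
        rw [this, smul_smul, smul_smul, ← smul_assoc]
        congr 1
        simp only [powValue, smul_mul_assoc, mul_smul_comm, smul_smul]
        rw [mul_comm _ (D.lam 0), hχ, sub_mul, mul_sub, ← map_mul, ← map_mul, mul_comm h, one_mul,
          mul_one]
      | hx j =>
        intro v hv
        have := D.shift_pow_x_smul j v
        rw [shift, hv] at this
        rw [this, smul_smul, smul_smul, ← smul_assoc]
        congr 1
        have e1 : D.lam 0 * (D.q 0 j.succ : k) ^ D.m 0 = D.lam 0 := by rw [hq, hχ]
        have e2 : (D.tail.χ j (D.g 0 ^ D.m 0) : k) = (D.q 0 j.succ : k) ^ D.m 0 := by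
          rw [map_pow, Units.val_pow_eq_pow_val]; rfl
        simp only [powValue, smul_mul_assoc, mul_smul_comm, smul_smul]
        rw [mul_comm _ (D.lam 0), e1, sub_mul, mul_sub, grp_mul_x, e2, one_mul, mul_one, smul_sub,
          smul_sub, smul_smul, e1]
      | hadd a b ha hb =>
        intro v hv
        rw [add_smul, map_add, ha v hv, hb v hv, smul_add]
      | hmul a b ha hb =>
        intro v hv
        rw [mul_smul]
        exact ha _ (hb v hv)
      | hsmul c a ha =>
        intro v hv
        rw [smul_assoc, map_smul, ha v hv, smul_comm])
  rw [shift, key, ← lmul, powValue, map_smul, map_sub, map_one]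

/-- The representation of `H` on truncated skew polynomials in `x_0`. -/
noncomputable def rep : D.H →ₐ[k] Module.End k (ZMod (D.m 0) → D.tail.H) :=
  D.lift ((D.lmul : D.tail.H →* Module.End k (ZMod (D.m 0) → D.tail.H)).comp D.tail.grp)
    (Fin.cons D.shift fun j => D.lmul (D.tail.x j))
    (by
      intro h i
      refine Fin.cases ?_ (fun j => ?_) i
      · simp only [Fin.cons_zero, MonoidHom.comp_apply]
        have := D.shift_mul_grp h
        rw [Units.val_inv_eq_inv_val, eq_inv_smul_iff₀ (Units.ne_zero _)] at this
        exact this.symm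
      · have := congrArg (D.lmul) (D.tail.grp_mul_x h j)
        rw [map_mul, map_smul, map_mul] at this
        exact this)
    (by
      intro i j
      refine Fin.cases ?_ (fun i => ?_) i <;> refine Fin.cases ?_ (fun j => ?_) j
      · exact fun h => absurd rfl h
      · exact fun _ => D.shift_mul_x j
      · intro _
        have h1 : (D.q i.succ 0 : k) * D.q 0 i.succ = 1 := by
          rw [← Units.val_mul, q, q, D.χ_mul_χ 0 i.succ (Fin.succ_ne_zero i).symm, Units.val_one]
        -- The relation for x_i x_0 is a multiple of the one for x_0 x_i; the antisymmetry condition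
        -- on the linking parameters is what makes the inhomogeneous terms agree.
        have h2 := D.lamLink_add i.succ 0 (Fin.succ_ne_zero i)
        have h3 : ∀ z : Module.End k (ZMod (D.m 0) → D.tail.H), (D.q i.succ 0 : k) •
            D.lamLink 0 i.succ • z + D.lamLink i.succ 0 • z = 0 := by
          intro z
          rw [smul_smul, ← add_smul, add_comm (_ * _), q, h2, zero_smul]
        rw [Fin.cons_succ, Fin.cons_zero, D.shift_mul_x i, smul_add, smul_smul, h1, one_smul,
          mul_comm (D.g i.succ), add_assoc]
        exact ((congrArg (_ + ·) (h3 _)).trans (add_zero _)).symm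
      · intro hij
        have := congrArg (D.lmul)
          (D.tail.x_mul_x (i := i) (j := j) (by simpa using hij))
        rw [map_mul, map_add, map_smul, map_smul, map_mul, map_sub, map_one] at this
        exact this)
    (by
      intro i
      refine Fin.cases ?_ (fun j => ?_) i
      · exact D.shift_pow
      · have := congrArg (D.lmul) (D.tail.x_pow j)
        rw [map_pow, map_smul, map_sub, map_one] at this
        exact this)

theorem rep_grp (h : G) : D.rep (D.grp h)
    = D.lmul (D.tail.grp h) :=
  D.lift_grp _ _ _ _ _ h

theorem rep_x_zero : D.rep (D.x 0) = D.shift := D.lift_x _ _ _ _ _ 0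

theorem rep_x_succ (j : Fin n) : D.rep (D.x j.succ)
    = D.lmul (D.tail.x j) := D.lift_x _ _ _ _ _ j.succ

theorem rep_tailHom (a : D.tail.H) : D.rep (D.tailHom a)
    = D.lmul a := by
  have : D.rep.comp D.tailHom = D.lmul :=
    D.tail.algHom_ext (fun h => by simp [rep_grp]) (fun j => by simp [rep_x_succ])
  exact DFunLike.congr_fun this a

/-- The vector (a_r) is the image of ∑ a_r x_0^r, so the first basis vector is cyclic. -/
theorem rep_surjective :
    Function.Surjective fun a : D.H => D.rep a (Pi.single 0 1 : ZMod (D.m 0) → D.tail.H) := by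
  intro v
  refine ⟨∑ r : ZMod (D.m 0), D.tailHom (v r) * D.x 0 ^ r.val, ?_⟩
  simp only [map_sum, map_mul, map_pow, rep_tailHom, rep_x_zero, LinearMap.sum_apply,
    Module.End.mul_apply]
  conv_rhs => rw [← Finset.univ_sum_single v]
  refine Finset.sum_congr rfl fun r _ => ?_
  rw [shift, skewShift_pow_single D.isSkewDerivation _ (ZMod.val_lt r), ZMod.natCast_zmod_val]
  rw [lmul_apply, ← Pi.single_smul, smul_eq_mul, mul_one]

theorem mul_finrank_tail_le : D.m 0 * Module.finrank k D.tail.H ≤ Module.finrank k D.H := by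
  have h := LinearMap.finrank_le_finrank_of_surjective
    (f := (LinearMap.applyₗ (Pi.single 0 1 : ZMod (D.m 0) → D.tail.H)) ∘ₗ D.rep.toLinearMap)
    D.rep_surjective
  rwa [Module.finrank_pi_fintype, Finset.sum_const, smul_eq_mul, Finset.card_univ, ZMod.card] at h

end skew

/-- Each generator multiplies the lower bound by m_i; with no generators, `H` maps onto the group
algebra. -/
theorem card_le_finrank {k G : Type*} [Field k] [CommGroup G] [Finite G] {n : ℕ}
    (D : LiftingDatum k G n) : (∏ i, D.m i) * Nat.card G ≤ Module.finrank k D.H := by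
  induction n with
  | zero =>
    have := Fintype.ofFinite G
    let f : D.H →ₐ[k] MonoidAlgebra k G := D.lift (MonoidAlgebra.of k G) (fun i => i.elim0)
      (fun _ i => i.elim0) (fun i => i.elim0) (fun i => i.elim0)
    have hf : Function.Surjective f.toLinearMap := by
      rw [← LinearMap.range_eq_top, eq_top_iff]
      intro a _
      induction a using MonoidAlgebra.induction_on with
      | of g => exact ⟨D.grp g, D.lift_grp _ _ _ _ _ g⟩
      | add a b ha hb => exact Submodule.add_mem _ (ha trivial) (hb trivial)
      | smul c a ha => exact Submodule.smul_mem _ c (ha trivial)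
    have h := LinearMap.finrank_le_finrank_of_surjective hf
    have hc : Module.finrank k (MonoidAlgebra k G) = Nat.card G := by
      rw [Nat.card_eq_fintype_card]
      exact Module.finrank_eq_card_basis (MonoidAlgebra.basis G k)
    simpa [hc] using h
  | succ n ih =>
    refine le_trans ?_ D.mul_finrank_tail_le
    rw [Fin.prod_univ_succ, mul_assoc]
    exact Nat.mul_le_mul_left _ (ih D.tail)

/-- The monomials form a basis of `H`. -/
theorem exists_basis_monomial {k G : Type*} [Field k] [CommGroup G] [Finite G] {n : ℕ}
    (D : LiftingDatum k G n) :
    ∃ b : Module.Basis ((∀ i, ZMod (D.m i)) × G) k D.H, ∀ r h, b (r, h) = D.monomial r h := by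
  have := Fintype.ofFinite G
  have hs := D.span_monomial.ge
  have hli := linearIndependent_of_top_le_span_of_card_le_finrank hs (by
    rw [Fintype.card_prod, Fintype.card_pi]
    simp only [ZMod.card]
    rw [← Nat.card_eq_fintype_card]
    exact D.card_le_finrank)
  exact ⟨Module.Basis.mk hli hs, fun r h => by rw [Module.Basis.mk_apply]⟩

end LiftingDatum

/-! ### Coproduct of the monomials -/

theorem List.prod_ofFn_sum {R : Type*} [Semiring R] {n : ℕ} {ι : Fin n → Type*}
    [∀ i, Fintype (ι i)] (f : ∀ i, ι i → R) :
    (List.ofFn fun i => ∑ s, f i s).prod = ∑ s : ∀ i, ι i, (List.ofFn fun i => f i (s i)).prod := by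
  induction n with
  | zero => simp
  | succ n ih =>
    rw [← Equiv.sum_comp (Fin.consEquiv ι), Fintype.sum_prod_type, List.ofFn_succ, List.prod_cons,
      ih, Finset.sum_mul]
    refine Finset.sum_congr rfl fun s _ => ?_
    rw [Finset.mul_sum]
    refine Finset.sum_congr rfl fun t _ => ?_
    rw [List.ofFn_succ, List.prod_cons]
    rfl

theorem List.prod_ofFn_smul_tmul {k A B : Type*} [Field k] [Ring A] [Algebra k A] [Ring B]
    [Algebra k B] {n : ℕ} (c : Fin n → k) (a : Fin n → A) (b : Fin n → B) :
    (List.ofFn fun i => c i • (a i ⊗ₜ[k] b i)).prod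
      = (∏ i, c i) • ((List.ofFn a).prod ⊗ₜ[k] (List.ofFn b).prod) := by
  induction n with
  | zero => simp [Algebra.TensorProduct.one_def]
  | succ n ih =>
    rw [List.ofFn_succ, List.prod_cons, ih, List.ofFn_succ, List.prod_cons, List.ofFn_succ,
      List.prod_cons, Fin.prod_univ_succ, smul_mul_smul_comm, Algebra.TensorProduct.tmul_mul_tmul]

/-- In the absorption identity the factor 1 - q^(r+1) is nonzero below the order of `q`, so
nonvanishing propagates by induction. -/
theorem gaussBinom_ne_zero {k : Type*} [Field k] {q : kˣ} {r : ℕ} :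
    ∀ {s : ℕ}, s ≤ r → r < orderOf q → gaussBinom (q : k) r s ≠ 0 := by
  induction r with
  | zero =>
    intro s hs _
    obtain rfl : s = 0 := by omega
    simp [gaussBinom]
  | succ r ih =>
    intro s hs hr
    cases s with
    | zero => simp [gaussBinom]
    | succ s =>
      intro h0
      have h := gaussBinom_absorb (q : k) r s
      rw [h0, mul_zero] at h
      refine (mul_ne_zero ?_ (ih (s := s) (by omega) (by omega))) h.symm
      intro h1
      have h3 : q ^ (r + 1) = 1 := by
        ext
        push_cast
        exact (sub_eq_zero.mp h1).symm
      exact pow_ne_one_of_lt_orderOf (by omega) hr h3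

namespace LiftingDatum

variable {k G : Type*} [Field k] [CommGroup G] {n : ℕ} (D : LiftingDatum k G n)

theorem grp_mul_prod_y (h : G) (e : Fin n → ℕ) (l : List (Fin n)) :
    D.grp h * (l.map fun i => D.y i ^ e i).prod
      = (l.map fun i => D.χ i h ^ e i).prod • ((l.map fun i => D.y i ^ e i).prod * D.grp h) := by
  induction l with
  | nil => simp
  | cons i l ih =>
    simp only [List.map_cons, List.prod_cons]
    rw [← mul_assoc, grp_mul_y_pow, smul_mul_assoc, mul_assoc, ih, mul_smul_comm, smul_smul,
      mul_assoc]

theorem monomial_zero (h : G) : D.monomial 0 h = D.grp h := by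
  simp [monomial_eq]

theorem monomial_zero_one : D.monomial 0 1 = 1 := by rw [monomial_zero, map_one]

theorem grp_mul_monomial (h h' : G) (r : ∀ i, ZMod (D.m i)) :
    D.grp h * D.monomial r h' = (∏ i, D.χ i h ^ (r i).val) • D.monomial r (h * h') := by
  rw [monomial_eq, monomial_eq, List.ofFn_eq_map, ← mul_assoc,
    D.grp_mul_prod_y h (fun i => (r i).val), smul_mul_assoc, mul_assoc, ← map_mul,
    ← List.ofFn_eq_map, List.prod_ofFn]

/-- Group elements are collected on the right at the cost of a unit. The normalisation for zero
exponents later makes the coefficient of the term s = r equal to 1. -/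
theorem prod_grp_mul_y (a : Fin n → G) (e : Fin n → ℕ) (l : List (Fin n)) :
    ∃ u : kˣ, ((∀ i, e i = 0) → u = 1) ∧ (l.map fun i => D.grp (a i) * D.y i ^ e i).prod
      = u • ((l.map fun i => D.y i ^ e i).prod * D.grp (l.map a).prod) := by
  induction l with
  | nil => exact ⟨1, by simp⟩
  | cons i l ih =>
    obtain ⟨u, hu, h⟩ := ih
    refine ⟨D.χ i (a i) ^ e i * u * (l.map fun j => D.χ j (a i) ^ e j).prod, ?_, ?_⟩
    · intro he
      simp [he, hu he]
    · simp only [List.map_cons, List.prod_cons]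
      rw [h, grp_mul_y_pow, smul_mul_smul_comm, mul_smul, mul_assoc (D.y i ^ e i),
        ← mul_assoc (D.grp _), D.grp_mul_prod_y (a i) e l, smul_mul_assoc, mul_smul_comm,
        map_mul, ← mul_assoc, ← mul_assoc, ← mul_assoc, smul_smul, smul_smul, mul_assoc (_ ^ _) u]

/-- The group element `g_1 ^ (-s_1) ⋯ g_n ^ (-s_n)`. -/
noncomputable def gProd (s : ∀ i, ZMod (D.m i)) : G := ∏ i, (D.g i)⁻¹ ^ (s i).val

theorem gProd_zero : D.gProd 0 = 1 := by simp [gProd]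

section

variable [Finite G]

theorem comul_apply (a : D.H) : Coalgebra.comul (R := k) a = D.comulHom a := rfl

theorem counit_apply (a : D.H) : Coalgebra.counit (R := k) a = D.counitHom a := rfl

/-- The two summands commute up to q_ii, so powers of y_i expand with Gaussian binomials; the left
factors are pure powers of y_i. -/
theorem comulHom_y (i : Fin n) :
    D.comulHom (D.y i) = 1 ⊗ₜ[k] D.y i + D.y i ⊗ₜ[k] D.grp (D.g i)⁻¹ := by
  rw [y, map_mul, comulHom_x, comulHom_grp, add_mul, Algebra.TensorProduct.tmul_mul_tmul,
    Algebra.TensorProduct.tmul_mul_tmul, grp_mul_grp_inv, one_mul]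

theorem comulHom_y_pow (i : Fin n) (r : ℕ) : D.comulHom (D.y i ^ r)
    = ∑ s ∈ Finset.range (r + 1), gaussBinom (D.q i i : k) r s •
      ((D.y i ^ s) ⊗ₜ[k] (D.grp ((D.g i)⁻¹ ^ s) * D.y i ^ (r - s))) := by
  have h : ((1 : D.H) ⊗ₜ[k] D.y i) * (D.y i ⊗ₜ[k] D.grp (D.g i)⁻¹)
      = (D.q i i : k) • ((D.y i ⊗ₜ[k] D.grp (D.g i)⁻¹) * ((1 : D.H) ⊗ₜ[k] D.y i)) := by
    rw [Algebra.TensorProduct.tmul_mul_tmul, Algebra.TensorProduct.tmul_mul_tmul, y_mul_grp,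
      one_mul, mul_one, map_inv, inv_inv, Units.smul_def, TensorProduct.tmul_smul]
    rfl
  rw [map_pow, comulHom_y, add_comm, qcomm_add_pow h]
  refine Finset.sum_congr rfl fun s _ => ?_
  rw [Algebra.TensorProduct.tmul_pow, Algebra.TensorProduct.tmul_pow,
    Algebra.TensorProduct.tmul_mul_tmul, one_pow, mul_one, ← map_pow]

theorem comulHom_y_pow_val (i : Fin n) (r : ZMod (D.m i)) : D.comulHom (D.y i ^ r.val)
    = ∑ s : ZMod (D.m i), gaussBinom (D.q i i : k) r.val s.val •
      ((D.y i ^ s.val) ⊗ₜ[k] (D.grp ((D.g i)⁻¹ ^ s.val) * D.y i ^ (r.val - s.val))) := by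
  have hr := ZMod.val_lt r
  rw [comulHom_y_pow, Finset.sum_subset (s₂ := Finset.range (D.m i))]
  · refine Finset.sum_bij' (fun s _ => (s : ZMod (D.m i))) (fun s _ => s.val) ?_ ?_ ?_ ?_ ?_
    · simp
    · intro s _; simpa using ZMod.val_lt s
    · intro s hs; exact ZMod.val_cast_of_lt (by simpa using hs)
    · intro s _; exact ZMod.natCast_zmod_val s
    · intro s hs
      rw [ZMod.val_cast_of_lt (by simpa using hs)]
  · intro s hs
    simp only [Finset.mem_range] at hs ⊢
    omega
  · intro s _ hs
    rw [gaussBinom_of_lt _ _ _ (by simpa using hs), zero_smul]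

/-- The factors are expanded in their given order, so no relation between different x_i is used. The
coefficients are products of Gaussian binomials below the order of q_ii, times units. -/
theorem comulHom_monomial (r : ∀ i, ZMod (D.m i)) (h : G) :
    ∃ c : (∀ i, ZMod (D.m i)) → k, c r = 1 ∧ (∀ s, c s ≠ 0 ↔ ∀ i, (s i).val ≤ (r i).val) ∧
      D.comulHom (D.monomial r h)
        = ∑ s, c s • (D.monomial s h ⊗ₜ[k] D.monomial (r - s) (D.gProd s * h)) := by
  have hu := fun s : ∀ i, ZMod (D.m i) => D.prod_grp_mul_y (fun i => (D.g i)⁻¹ ^ (s i).val)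
    (fun i => (r i).val - (s i).val) (List.finRange n)
  choose u hu1 hu using hu
  simp only [← List.ofFn_eq_map] at hu
  -- Subtraction modulo m_i agrees with subtraction of representatives only for s ≤ r; all other
  -- terms have coefficient zero.
  have hval : ∀ s : ∀ i, ZMod (D.m i), (∀ i, (s i).val ≤ (r i).val) →
      ∀ i, ((r - s) i).val = (r i).val - (s i).val := fun s hs i => ZMod.val_sub (hs i)
  have hc : ∀ s : ∀ i, ZMod (D.m i),
      (∏ i, gaussBinom (D.q i i : k) (r i).val (s i).val) ≠ 0 ↔ ∀ i, (s i).val ≤ (r i).val := by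
    intro s
    rw [Finset.prod_ne_zero_iff]
    refine ⟨fun h i => ?_, fun h i _ => gaussBinom_ne_zero (h i) (ZMod.val_lt (r i))⟩
    by_contra h0
    exact h i (Finset.mem_univ i) (gaussBinom_of_lt _ _ _ (by omega))
  refine ⟨fun s => (∏ i, gaussBinom (D.q i i : k) (r i).val (s i).val) * u s, ?_, ?_, ?_⟩
  · simp [gaussBinom_self, hu1 r]
  · intro s
    rw [← hc, mul_ne_zero_iff]
    simp
  · rw [monomial_eq, map_mul, map_list_prod, List.map_ofFn]
    simp only [Function.comp_def, comulHom_y_pow_val]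
    rw [List.prod_ofFn_sum, Finset.sum_mul]
    refine Finset.sum_congr rfl fun s _ => ?_
    rw [List.prod_ofFn_smul_tmul, comulHom_grp, smul_mul_assoc,
      Algebra.TensorProduct.tmul_mul_tmul, ← monomial_eq]
    by_cases hs : ∀ i, (s i).val ≤ (r i).val
    · rw [mul_smul, hu s, ← Units.smul_def (u s), smul_mul_assoc, mul_assoc, ← map_mul,
        List.prod_ofFn, ← gProd, monomial_eq (r := r - s)]
      simp only [hval s hs]
      rw [Units.smul_def, Units.smul_def, TensorProduct.tmul_smul]
    · rw [not_not.mp (mt (hc s).mp hs)]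
      simp

/-- The basis of monomials. -/
noncomputable def basis : Module.Basis ((∀ i, ZMod (D.m i)) × G) k D.H :=
  D.exists_basis_monomial.choose

theorem basis_apply (p : (∀ i, ZMod (D.m i)) × G) : D.basis p = D.monomial p.1 p.2 :=
  D.exists_basis_monomial.choose_spec p.1 p.2

open Classical in
theorem coord_monomial (p : (∀ i, ZMod (D.m i)) × G) (r : ∀ i, ZMod (D.m i)) (h : G) :
    D.basis.coord p (D.monomial r h) = if (r, h) = p then 1 else 0 := by
  rw [← D.basis_apply (r, h), Module.Basis.coord_apply, Module.Basis.repr_self,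
    Finsupp.single_apply]

end

end LiftingDatum

/-! ### Frobenius homomorphisms and Nakayama automorphisms -/

section Frobenius

variable {k A : Type*} [Field k] [Ring A] [Algebra k A] {φ : Module.Dual k A}

theorem isFrobeniusHom_of_forall [Module.Finite k A]
    (h : ∀ x, (∀ y, φ (y * x) = 0) → x = 0) : IsFrobeniusHom φ := by
  let f : A →ₗ[k] Module.Dual k A :=
    { toFun := fun x => φ ∘ₗ LinearMap.mulRight k x
      map_add' := fun a b => by ext; simp [mul_add]
      map_smul' := fun c a => by ext; simp }
  have hf : Function.Injective f := by
    rw [← LinearMap.ker_eq_bot, LinearMap.ker_eq_bot']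
    exact fun x hx => h x fun y => LinearMap.congr_fun hx y
  exact ⟨hf, (LinearMap.injective_iff_surjective_of_finrank_eq_finrank
    Subspace.dual_finrank_eq.symm).mp hf⟩

/-- Every functional is of the form φ(· y), so the hypothesis says that all functionals agree on the
two elements. -/
theorem IsFrobeniusHom.eq_of_forall_mul_left (hφ : IsFrobeniusHom φ) {x x' : A}
    (h : ∀ y, φ (x * y) = φ (x' * y)) : x = x' := by
  rw [← sub_eq_zero, ← Module.forall_dual_apply_eq_zero_iff k]
  intro f
  obtain ⟨y, rfl⟩ := hφ.2 f
  simp [sub_mul, h]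

theorem IsFrobeniusHom.exists_mul_left [Module.Finite k A] (hφ : IsFrobeniusHom φ)
    (f : Module.Dual k A) : ∃ x, ∀ y, φ (x * y) = f y := by
  let F : A →ₗ[k] Module.Dual k A :=
    { toFun := fun x => φ ∘ₗ LinearMap.mulLeft k x
      map_add' := fun a b => by ext; simp [add_mul]
      map_smul' := fun c a => by ext; simp }
  have hF : Function.Injective F := fun x x' h =>
    hφ.eq_of_forall_mul_left fun y => LinearMap.congr_fun h y
  obtain ⟨x, hx⟩ := (LinearMap.injective_iff_surjective_of_finrank_eq_finrank
    Subspace.dual_finrank_eq.symm).mp hF f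
  exact ⟨x, fun y => LinearMap.congr_fun hx y⟩

/-- Nondegeneracy on the other side represents y ↦ φ(yx) as φ(ρ(x) ·); uniqueness of the
representing element makes ρ multiplicative. -/
theorem IsFrobeniusHom.existsUnique_nakayama [Module.Finite k A] (hφ : IsFrobeniusHom φ) :
    ∃! ρ : A ≃ₐ[k] A, IsNakayamaAut φ ρ := by
  have hex : ∀ x : A, ∃ z, ∀ y, φ (z * y) = φ (y * x) := fun x =>
    hφ.exists_mul_left (φ ∘ₗ LinearMap.mulRight k x)
  choose r hr using hex
  let R : A →ₐ[k] A :=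
    { toFun := r
      map_one' := hφ.eq_of_forall_mul_left fun y => by simp [hr]
      map_mul' := fun a b => hφ.eq_of_forall_mul_left fun y => by
        rw [hr, mul_assoc, hr a, mul_assoc, hr b, mul_assoc]
      map_zero' := hφ.eq_of_forall_mul_left fun y => by simp [hr]
      map_add' := fun a b => hφ.eq_of_forall_mul_left fun y => by
        simp [hr, add_mul, mul_add]
      commutes' := fun c => hφ.eq_of_forall_mul_left fun y => by
        rw [hr, Algebra.commutes] }
  have hR : Function.Injective R.toLinearMap := fun a b hab => hφ.1 (by
    ext y
    have h : r a = r b := hab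
    rw [LinearMap.comp_apply, LinearMap.comp_apply, LinearMap.mulRight_apply,
      LinearMap.mulRight_apply, ← hr a, h, hr b])
  refine ⟨AlgEquiv.ofBijective R ⟨hR, LinearMap.injective_iff_surjective.mp hR⟩,
    fun x y => (hr x y).symm, fun ρ hρ => ?_⟩
  ext x
  exact hφ.eq_of_forall_mul_left fun y => (hρ x y).symm.trans (hr x y).symm

end Frobenius

/-! ### Right integrals in the dual of a bialgebra -/

section contract

variable {k A : Type*} [Field k] [Ring A] [Algebra k A]

/-- The map `a ⊗ b ↦ φ(a) b`. -/
noncomputable def contract (φ : Module.Dual k A) : A ⊗[k] A →ₗ[k] A :=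
  (TensorProduct.lid k A).toLinearMap ∘ₗ φ.rTensor A

@[simp] theorem contract_tmul (φ : Module.Dual k A) (a b : A) :
    contract φ (a ⊗ₜ[k] b) = φ a • b := by
  simp [contract]

theorem contract_mul (φ : Module.Dual k A) (a : A) (t : A ⊗[k] A) :
    contract φ ((1 ⊗ₜ[k] a) * t) = a * contract φ t := by
  induction t with
  | zero => simp
  | add t t' h h' => rw [mul_add, map_add, h, h', map_add, mul_add]
  | tmul b c => simp

theorem contract_mul_right (φ : Module.Dual k A) (a : A) (t : A ⊗[k] A) :
    contract φ (t * (1 ⊗ₜ[k] a)) = contract φ t * a := by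
  induction t with
  | zero => simp
  | add t t' h h' => rw [add_mul, map_add, h, h', map_add, add_mul]
  | tmul b c => simp

theorem contract_comp_mulLeft (φ : Module.Dual k A) (a : A) (t : A ⊗[k] A) :
    contract (φ ∘ₗ LinearMap.mulLeft k a) t = contract φ ((a ⊗ₜ[k] 1) * t) := by
  induction t with
  | zero => simp
  | add t t' h h' => rw [mul_add, map_add, h, h', map_add]
  | tmul b c => simp

theorem contract_comp_mulRight (φ : Module.Dual k A) (a : A) (t : A ⊗[k] A) :
    contract (φ ∘ₗ LinearMap.mulRight k a) t = contract φ (t * (a ⊗ₜ[k] 1)) := by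
  induction t with
  | zero => simp
  | add t t' h h' => rw [add_mul, map_add, h, h', map_add]
  | tmul b c => simp

theorem contract_sub (φ ψ : Module.Dual k A) (t : A ⊗[k] A) :
    contract (φ - ψ) t = contract φ t - contract ψ t := by
  simp [contract, LinearMap.rTensor_sub]

theorem contract_smul (c : k) (φ : Module.Dual k A) (t : A ⊗[k] A) :
    contract (c • φ) t = c • contract φ t := by
  simp [contract, LinearMap.rTensor_smul]

/-- Functionals separate points, so the test functional can be dropped and the condition becomes an
identity in the algebra. -/
theorem isRightIntegralDual_iff {A : Type*} [Ring A] [Bialgebra k A] (φ : Module.Dual k A) :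
    IsRightIntegralDual φ ↔ ∀ a, contract φ (Coalgebra.comul a) = φ a • 1 := by
  have key : ∀ (f : Module.Dual k A) (t : A ⊗[k] A),
      LinearMap.mul' k k (TensorProduct.map φ f t) = f (contract φ t) := by
    intro f t
    induction t with
    | zero => simp
    | add t t' h h' => rw [map_add, map_add, h, h', map_add, map_add]
    | tmul b c => simp
  constructor
  · intro h a
    rw [← sub_eq_zero, ← Module.forall_dual_apply_eq_zero_iff k]
    intro f
    have := LinearMap.congr_fun (h f) a
    simp only [LinearMap.comp_apply, key, LinearMap.smul_apply] at this
    rw [map_sub, this, map_smul, smul_eq_mul, smul_eq_mul, mul_comm, sub_self]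
  · intro h f
    ext a
    simp only [LinearMap.comp_apply, key, LinearMap.smul_apply, h, map_smul, smul_eq_mul, mul_comm]

end contract

/-! ### Integrals of liftings of quantum linear spaces -/

namespace LiftingDatum

variable {k G : Type*} [Field k] [CommGroup G] [Finite G] {n : ℕ} (D : LiftingDatum k G n)

/-- The group part of the monomial on which the right integrals are supported. -/
noncomputable def topGrp : G := (D.gProd (-1))⁻¹

theorem val_neg_one (i : Fin n) : ((-1 : ∀ i, ZMod (D.m i)) i).val = D.m i - 1 := by
  have h := D.one_lt_m i
  rw [Pi.neg_apply, Pi.one_apply]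
  have : Fact (1 < D.m i) := ⟨h⟩
  rw [ZMod.neg_val, if_neg one_ne_zero, ZMod.val_one]

variable {D}

theorem integral_sum {φ : Module.Dual k D.H} (hφ : IsRightIntegralDual φ)
    {r : ∀ i, ZMod (D.m i)} {h : G} {c : (∀ i, ZMod (D.m i)) → k}
    (hc : D.comulHom (D.monomial r h)
        = ∑ s, c s • (D.monomial s h ⊗ₜ[k] D.monomial (r - s) (D.gProd s * h))) :
    ∑ s, (c s * φ (D.monomial s h)) • D.monomial (r - s) (D.gProd s * h)
      = φ (D.monomial r h) • D.monomial 0 1 := by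
  have := (isRightIntegralDual_iff φ).mp hφ (D.monomial r h)
  rw [comul_apply, hc, map_sum] at this
  rw [monomial_zero_one, ← this]
  simp [smul_smul]

/-- If s_i < m_i - 1, the exponent s + e_i does not wrap around. In the integral identity for that
monomial the coefficient of y_i times a group element is a nonzero multiple of the value sought,
while the right-hand side is a multiple of 1. -/
theorem integral_monomial_of_ne {φ : Module.Dual k D.H} (hφ : IsRightIntegralDual φ)
    {s : ∀ i, ZMod (D.m i)} (hs : s ≠ -1) (h : G) : φ (D.monomial s h) = 0 := by
  classical
  obtain ⟨i, hi⟩ := Function.ne_iff.mp hs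
  have : Fact (1 < D.m i) := ⟨D.one_lt_m i⟩
  obtain ⟨c, -, hc, hΔ⟩ := D.comulHom_monomial (s + Pi.single i 1) h
  have h1 := congrArg (D.basis.coord (Pi.single i 1, D.gProd s * h)) (integral_sum hφ hΔ)
  rw [map_sum, Finset.sum_eq_single s] at h1
  · have hne : (Pi.single i 1 : ∀ i, ZMod (D.m i)) ≠ 0 := by simp
    rw [map_smul, map_smul, coord_monomial, coord_monomial, if_pos (by simp),
      if_neg (fun h => hne (Prod.ext_iff.mp h).1.symm)] at h1
    have hcs : c s ≠ 0 := by
      rw [hc]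
      intro j
      by_cases hj : j = i
      · subst hj
        rw [Pi.add_apply, Pi.single_eq_same]
        have hlt : (s j).val + 1 < D.m j := by
          have h2 := ZMod.val_lt (s j)
          have h3 : (s j).val ≠ D.m j - 1 := by
            intro h3
            rw [← D.val_neg_one] at h3
            exact hi (ZMod.val_injective _ h3)
          omega
        rw [ZMod.val_add_of_lt (by rwa [ZMod.val_one]), ZMod.val_one]
        omega
      · simp [hj]
    simpa [hcs] using h1
  · intro s' _ hs'
    rw [map_smul, coord_monomial, if_neg, smul_zero]
    intro h2
    refine hs' ?_
    have h3 := (Prod.ext_iff.mp h2).1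
    simp only at h3
    rw [sub_eq_iff_eq_add, add_comm] at h3
    exact (add_left_cancel h3).symm
  · simp

/-- Comparing coefficients of 1: a left-hand term has degree zero only for s = -1, and its group
part is then 1 only for one choice of `h`. -/
theorem integral_monomial_top_of_ne {φ : Module.Dual k D.H} (hφ : IsRightIntegralDual φ)
    {h : G} (hh : h ≠ D.topGrp) : φ (D.monomial (-1) h) = 0 := by
  classical
  obtain ⟨c, -, hc, hΔ⟩ := D.comulHom_monomial (-1) h
  have h1 := congrArg (D.basis.coord (0, 1)) (integral_sum hφ hΔ)
  rw [map_sum, Finset.sum_eq_zero] at h1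
  · rw [map_smul, coord_monomial, if_pos rfl] at h1
    simpa using h1.symm
  · intro s _
    rw [map_smul, coord_monomial, if_neg, smul_zero]
    intro h2
    obtain ⟨h3, h4⟩ := Prod.ext_iff.mp h2
    simp only at h3 h4
    rw [← sub_eq_zero.mp h3] at h4
    exact hh (eq_inv_of_mul_eq_one_right h4)

theorem integral_ext {φ ψ : Module.Dual k D.H} (hφ : IsRightIntegralDual φ)
    (hψ : IsRightIntegralDual ψ)
    (h : φ (D.monomial (-1) D.topGrp) = ψ (D.monomial (-1) D.topGrp)) : φ = ψ := by
  refine D.basis.ext fun ⟨s, t⟩ => ?_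
  rw [basis_apply]
  by_cases hs : s = -1
  · subst hs
    by_cases ht : t = D.topGrp
    · subst ht; exact h
    · rw [integral_monomial_top_of_ne hφ ht, integral_monomial_top_of_ne hψ ht]
  · rw [integral_monomial_of_ne hφ hs, integral_monomial_of_ne hψ hs]

theorem integral_top_ne_zero {φ : Module.Dual k D.H} (hφ : IsRightIntegralDual φ) (h0 : φ ≠ 0) :
    φ (D.monomial (-1) D.topGrp) ≠ 0 := by
  intro h
  refine h0 (integral_ext hφ ?_ (by rw [h]; rfl))
  rw [isRightIntegralDual_iff]
  simp [contract]

/-- Right integrals are unique up to scalars. -/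
theorem integral_eq_smul {φ ψ : Module.Dual k D.H} (hφ : IsRightIntegralDual φ) (h0 : φ ≠ 0)
    (hψ : IsRightIntegralDual ψ) : ∃ c : k, ψ = c • φ := by
  refine ⟨ψ (D.monomial (-1) D.topGrp) / φ (D.monomial (-1) D.topGrp), integral_ext hψ ?_ ?_⟩
  · rw [isRightIntegralDual_iff] at hφ ⊢
    intro a
    rw [contract_smul, hφ, LinearMap.smul_apply, smul_assoc]
  · rw [LinearMap.smul_apply, smul_eq_mul, div_mul_cancel₀ _ (integral_top_ne_zero hφ h0)]

variable (D)

theorem isRightIntegralDual_coord :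
    IsRightIntegralDual (D.basis.coord (-1, D.topGrp)) := by
  classical
  set φ := D.basis.coord (-1, D.topGrp) with hφ
  have hφm : ∀ r h, φ (D.monomial r h) = if r = -1 ∧ h = D.topGrp then 1 else 0 := by
    intro r h
    rw [hφ, coord_monomial]
    simp only [Prod.mk.injEq]
  rw [isRightIntegralDual_iff]
  suffices contract φ ∘ₗ D.comulHom.toLinearMap = φ.smulRight 1 from
    fun a => LinearMap.congr_fun this a
  refine D.basis.ext fun ⟨r, h⟩ => ?_
  obtain ⟨c, hc1, hc, hΔ⟩ := D.comulHom_monomial r h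
  rw [basis_apply, LinearMap.comp_apply, LinearMap.smulRight_apply]
  simp only [AlgHom.toLinearMap_apply, hΔ, map_sum, map_smul, contract_tmul, hφm]
  rw [Finset.sum_eq_single (-1)]
  · by_cases hr : r = -1
    · subst hr
      by_cases hh : h = D.topGrp
      · subst hh
        rw [hc1, if_pos ⟨rfl, rfl⟩, sub_self, topGrp, mul_inv_cancel, monomial_zero_one]
        simp
      · simp [hh]
    -- The top exponent satisfies s ≤ r only when r is itself the top exponent.
    · have : c (-1) = 0 := by
        by_contra h0
        rw [← ne_eq, hc] at h0
        refine hr (funext fun i => ZMod.val_injective _ ?_)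
        have h1 := h0 i
        have h2 := ZMod.val_lt (r i)
        rw [val_neg_one] at h1 ⊢
        omega
      simp [this, hr]
  · intro s _ hs
    simp [hs]
  · simp

theorem exists_integral : ∃ φ : Module.Dual k D.H, φ ≠ 0 ∧ IsRightIntegralDual φ := by
  classical
  refine ⟨_, fun h => ?_, D.isRightIntegralDual_coord⟩
  have := LinearMap.congr_fun h (D.monomial (-1) D.topGrp)
  rw [coord_monomial, if_pos rfl] at this
  simp at this

variable {D}

/-- The elements annihilated by φ on the left form a left ideal. Replacing `x` by hx or x_i x and
cancelling group elements in the second factor passes from `z` to `z * a` for each generator `a`,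
which replaces an argument with the antipode; the start z = 1 is the integral property. -/
theorem contract_eq_zero {φ : Module.Dual k D.H} (hφ : IsRightIntegralDual φ) {x : D.H}
    (hx : ∀ z, φ (z * x) = 0) (z : D.H) : contract φ ((z ⊗ₜ[k] 1) * D.comulHom x) = 0 := by
  have key : ∀ a z : D.H,
      (∀ x, (∀ z, φ (z * x) = 0) → contract φ ((z ⊗ₜ[k] 1) * D.comulHom x) = 0) →
      ∀ x, (∀ z, φ (z * x) = 0) → contract φ (((z * a) ⊗ₜ[k] 1) * D.comulHom x) = 0 := by
    have hgrp : ∀ (h : G) (z : D.H),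
        (∀ x, (∀ z, φ (z * x) = 0) → contract φ ((z ⊗ₜ[k] 1) * D.comulHom x) = 0) →
        ∀ x, (∀ z, φ (z * x) = 0) →
          contract φ (((z * D.grp h) ⊗ₜ[k] 1) * D.comulHom x) = 0 := by
      intro h z hz x hx
      have h1 := hz (D.grp h * x) (fun w => by rw [← mul_assoc, hx])
      have h2 : (z ⊗ₜ[k] (1 : D.H)) * (D.grp h ⊗ₜ[k] D.grp h)
          = (1 ⊗ₜ[k] D.grp h) * ((z * D.grp h) ⊗ₜ[k] 1) := by simp
      rw [map_mul D.comulHom, comulHom_grp, ← mul_assoc, h2, mul_assoc, contract_mul] at h1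
      have h3 := congrArg (D.grp h⁻¹ * ·) h1
      simpa only [← mul_assoc, grp_inv_mul_grp, one_mul, mul_zero] using h3
    intro a
    induction a using D.induction_on with
    | hg h => exact hgrp h
    | hx i =>
      intro z hz x hx
      have h1 := hz (D.x i * x) (fun w => by rw [← mul_assoc, hx])
      have h2 : (z ⊗ₜ[k] (1 : D.H)) * (D.grp (D.g i) ⊗ₜ[k] D.x i + D.x i ⊗ₜ[k] 1)
          = (1 ⊗ₜ[k] D.x i) * ((z * D.grp (D.g i)) ⊗ₜ[k] 1) + (z * D.x i) ⊗ₜ[k] 1 := by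
        simp [mul_add]
      rw [map_mul D.comulHom, comulHom_x, ← mul_assoc, h2, add_mul, mul_assoc, map_add,
        contract_mul, hgrp _ z hz x hx, mul_zero, zero_add] at h1
      exact h1
    | hadd a b ha hb =>
      intro z hz x hx
      rw [mul_add, TensorProduct.add_tmul, add_mul, map_add, ha z hz x hx, hb z hz x hx, add_zero]
    | hmul a b ha hb =>
      intro z hz
      rw [← mul_assoc]
      exact hb _ (ha z hz)
    | hsmul c a ha =>
      intro z hz x hx
      rw [mul_smul_comm, ← TensorProduct.smul_tmul', smul_mul_assoc, map_smul, ha z hz x hx,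
        smul_zero]
  have h1 := key z 1 (fun x hx => by
    have := (isRightIntegralDual_iff φ).mp hφ x
    rw [← Algebra.TensorProduct.one_def, one_mul, ← comul_apply, this, ← one_mul x, hx, zero_smul])
    x hx
  rwa [one_mul] at h1

/-- For `x` in the radical of the form, one looks at a monomial of maximal total degree in `x`. In
the second tensor factor of Δ(x) it arises only from the term s = 0 of itself, which forces φ(z h) =
0 for all `z`, and so φ = 0. -/
theorem isFrobeniusHom_integral {φ : Module.Dual k D.H} (h0 : φ ≠ 0)
    (hφ : IsRightIntegralDual φ) : IsFrobeniusHom φ := by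
  classical
  have := Fintype.ofFinite G
  refine isFrobeniusHom_of_forall fun x hx => ?_
  by_contra hx0
  have hsupp : (D.basis.repr x).support.Nonempty := by
    rw [Finsupp.support_nonempty_iff]
    simpa using hx0
  obtain ⟨⟨r, h⟩, hrh, hmax⟩ := Finset.exists_max_image _
    (fun p : (∀ i, ZMod (D.m i)) × G => ∑ i, (p.1 i).val) hsupp
  rw [Finsupp.mem_support_iff] at hrh
  choose c hc1 hc hΔ using fun p : (∀ i, ZMod (D.m i)) × G => D.comulHom_monomial p.1 p.2
  have hgrp : ∀ z, φ (z * D.grp h) = 0 := by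
    intro z
    have h1 := congrArg (D.basis.coord (r, h)) (contract_eq_zero hφ hx z)
    rw [map_zero, ← D.basis.sum_repr x] at h1
    simp only [map_sum, map_smul, basis_apply, hΔ, Finset.mul_sum, mul_smul_comm,
      Algebra.TensorProduct.tmul_mul_tmul, contract_tmul, one_mul, coord_monomial] at h1
    rw [Finset.sum_eq_single (r, h), Finset.sum_eq_single 0, if_pos (by simp [gProd_zero])] at h1
    · have h2 : c (r, h) 0 ≠ 0 := by rw [hc]; simp
      simpa [monomial_zero, hrh, h2] using h1
    · intro s _ hs
      rw [if_neg, smul_zero, smul_zero]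
      intro h2
      exact hs (by simpa using (Prod.ext_iff.mp h2).1)
    · simp
    · rintro ⟨r', h'⟩ _ hne
      by_cases hx' : D.basis.repr x (r', h') = 0
      · rw [hx', zero_smul]
      rw [Finset.sum_eq_zero, smul_zero]
      intro s _
      by_cases hcs : c (r', h') s = 0
      · rw [hcs, zero_smul]
      rw [if_neg, smul_zero, smul_zero]
      intro h2
      obtain ⟨h3, h4⟩ := Prod.ext_iff.mp h2
      simp only at h3 h4
      have hle := (hc (r', h') s).mp hcs
      simp only at hle
      have hmx := hmax (r', h') (by simpa using hx')
      simp only at hmx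
      have hsum : ∑ i, (r' i).val = ∑ i, (r i).val + ∑ i, (s i).val := by
        rw [← Finset.sum_add_distrib]
        refine Finset.sum_congr rfl fun i _ => ?_
        rw [← h3, Pi.sub_apply, ZMod.val_sub (hle i), Nat.sub_add_cancel (hle i)]
      have hs0 : s = 0 := by
        have : ∑ i, (s i).val = 0 := by omega
        funext i
        have h5 := Finset.sum_eq_zero_iff.mp this i (Finset.mem_univ i)
        simpa using h5
      subst hs0
      rw [sub_zero] at h3
      rw [gProd_zero, one_mul] at h4
      exact hne (by rw [h3, h4])
    · simp
  refine h0 (LinearMap.ext fun z => ?_)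
  have := hgrp (z * D.grp h⁻¹)
  rwa [mul_assoc, grp_inv_mul_grp, mul_one] at this

end LiftingDatum

/-! ### Diagonal operators whose eigenvalues form a character -/

section diagonal

variable {k K V : Type*} [Field k] [Group K] [AddCommGroup V] [Module k V]
  {b : Module.Basis K k V} {θ : K →* kˣ} {f : Module.End k V}

theorem mem_eigenspace_iff_repr (hf : ∀ κ, f (b κ) = (θ κ : k) • b κ) (z : k) (v : V) :
    v ∈ Module.End.eigenspace f z ↔ ∀ κ, b.repr v κ ≠ 0 → (θ κ : k) = z := by
  have hrepr : ∀ κ, b.repr (f v) κ = (θ κ : k) * b.repr v κ := by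
    intro κ
    have : (b.coord κ) ∘ₗ f = (θ κ : k) • b.coord κ := by
      classical
      refine b.ext fun κ' => ?_
      simp only [LinearMap.comp_apply, hf, map_smul, LinearMap.smul_apply,
        Module.Basis.coord_apply, Module.Basis.repr_self, Finsupp.single_apply]
      split_ifs with h
      · rw [h]
      · simp
    exact LinearMap.congr_fun this v
  rw [Module.End.mem_eigenspace_iff]
  constructor
  · intro h κ hκ
    have h1 := hrepr κ
    rw [h, map_smul, Finsupp.smul_apply, smul_eq_mul] at h1
    exact (mul_right_cancel₀ hκ h1).symm
  · intro h
    refine b.repr.injective (Finsupp.ext fun κ => ?_)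
    rw [hrepr, map_smul, Finsupp.smul_apply, smul_eq_mul]
    by_cases hκ : b.repr v κ = 0
    · simp [hκ]
    · rw [h κ hκ]

theorem eigenspace_eq_span (hf : ∀ κ, f (b κ) = (θ κ : k) • b κ) (z : k) :
    Module.End.eigenspace f z
      = Submodule.span k (Set.range (b ∘ (Subtype.val : {κ // (θ κ : k) = z} → K))) := by
  ext v
  rw [mem_eigenspace_iff_repr hf, Set.range_comp, Subtype.range_val_subtype, b.mem_span_image]
  exact ⟨fun h κ hκ => h κ (by simpa using hκ), fun h κ hκ => h (by simpa using hκ)⟩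

theorem eigenspace_ne_bot_iff (hf : ∀ κ, f (b κ) = (θ κ : k) • b κ) (z : k) :
    Module.End.eigenspace f z ≠ ⊥ ↔ ∃ κ, (θ κ : k) = z := by
  rw [Submodule.ne_bot_iff]
  constructor
  · rintro ⟨v, hv, hv0⟩
    obtain ⟨κ, hκ⟩ : ∃ κ, b.repr v κ ≠ 0 := by
      by_contra! h
      exact hv0 (b.repr.injective (by ext κ; simp [h κ]))
    exact ⟨κ, (mem_eigenspace_iff_repr hf z v).mp hv κ hκ⟩
  · rintro ⟨κ, rfl⟩
    exact ⟨b κ, Module.End.mem_eigenspace_iff.mpr (hf κ), b.ne_zero κ⟩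

/-- The eigenspace is spanned by the basis vectors in a fibre of θ, and translation identifies this
fibre with the kernel. -/
theorem finrank_eigenspace_eq [Finite K] (hf : ∀ κ, f (b κ) = (θ κ : k) • b κ) (κ : K) :
    Module.finrank k (Module.End.eigenspace f (θ κ : k))
      = Nat.card {κ // (θ κ : k) = (1 : kˣ)} := by
  classical
  have := Fintype.ofFinite K
  rw [eigenspace_eq_span hf, finrank_span_eq_card
    (b.linearIndependent.comp _ Subtype.val_injective), ← Nat.card_eq_fintype_card]
  refine Nat.card_congr
    { toFun := fun x => ⟨x.1 * κ⁻¹, ?_⟩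
      invFun := fun x => ⟨x.1 * κ, ?_⟩
      left_inv := fun x => by simp
      right_inv := fun x => by simp }
  · have := Units.ext x.2
    rw [map_mul, this, map_inv, mul_inv_cancel]
  · have := Units.ext x.2
    rw [map_mul, this, one_mul]

theorem iSup_eigenspace_eq_top (hf : ∀ κ, f (b κ) = (θ κ : k) • b κ) :
    ⨆ ω : θ.range, Module.End.eigenspace f ((ω : kˣ) : k) = ⊤ := by
  rw [eq_top_iff, ← b.span_eq, Submodule.span_le]
  rintro _ ⟨κ, rfl⟩
  exact Submodule.mem_iSup_of_mem (⟨θ κ, κ, rfl⟩ : θ.range)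
    (Module.End.mem_eigenspace_iff.mpr (hf κ))

end diagonal

/-! ### The Nakayama automorphism and the modular element -/

theorem List.prod_ofFn_smul {k A : Type*} [Field k] [Ring A] [Algebra k A] {n : ℕ}
    (c : Fin n → kˣ) (a : Fin n → A) :
    (List.ofFn fun i => c i • a i).prod = (∏ i, c i) • (List.ofFn a).prod := by
  induction n with
  | zero => simp
  | succ n ih =>
    rw [List.ofFn_succ, List.prod_cons, ih, List.ofFn_succ, List.prod_cons, Fin.prod_univ_succ,
      smul_mul_smul_comm]

namespace LiftingDatum

variable {k G : Type*} [Field k] [CommGroup G] {n : ℕ} (D : LiftingDatum k G n)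

/-- The character `∏ χ_i ^ (m_i - 1)` of `G`. -/
noncomputable def topChar : G →* kˣ := ∏ i, D.χ i ^ (D.m i - 1)

theorem topChar_apply (h : G) : D.topChar h = ∏ i, D.χ i h ^ (D.m i - 1) := by
  simp [topChar, MonoidHom.finsetProd_apply]

variable [Finite G] {D} {φ : Module.Dual k D.H}

/-- Moving `h` across a monomial costs ∏ χ_i(h)^(r_i), and φ sees only r_i = m_i - 1. -/
theorem integral_grp_mul (hφ : IsRightIntegralDual φ) (h : G) (z : D.H) :
    φ (D.grp h * z) = D.topChar h * φ (z * D.grp h) := by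
  suffices φ ∘ₗ LinearMap.mulLeft k (D.grp h)
      = (D.topChar h : k) • (φ ∘ₗ LinearMap.mulRight k (D.grp h)) from LinearMap.congr_fun this z
  refine D.basis.ext fun ⟨r, t⟩ => ?_
  simp only [basis_apply, LinearMap.comp_apply, LinearMap.smul_apply, LinearMap.mulLeft_apply,
    LinearMap.mulRight_apply, grp_mul_monomial, monomial_mul_grp, Units.smul_def, map_smul]
  by_cases hr : r = -1
  · subst hr
    simp only [val_neg_one, topChar_apply, mul_comm h]
  · rw [integral_monomial_of_ne hφ hr, integral_monomial_of_ne hφ hr, smul_zero, smul_zero]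

theorem contract_mulRight_y (hφ : IsRightIntegralDual φ) (i : Fin n) (x : D.H) :
    contract (φ ∘ₗ LinearMap.mulRight k (D.y i)) (D.comulHom x)
      = φ (x * D.y i) • D.grp (D.g i) - φ x • (D.y i * D.grp (D.g i)) := by
  have h1 := (isRightIntegralDual_iff φ).mp hφ (x * D.y i)
  have h2 := (isRightIntegralDual_iff φ).mp hφ x
  rw [comul_apply] at h1 h2
  have h3 : D.y i ⊗ₜ[k] D.grp (D.g i)⁻¹ = (D.y i ⊗ₜ[k] 1) * (1 ⊗ₜ[k] D.grp (D.g i)⁻¹) := by simp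
  rw [map_mul D.comulHom, comulHom_y, mul_add, map_add, contract_mul_right, h2, h3, ← mul_assoc,
    contract_mul_right, ← contract_comp_mulRight, smul_mul_assoc, one_mul] at h1
  have h4 := congrArg (· * D.grp (D.g i)) (eq_sub_of_add_eq' h1)
  simpa only [mul_assoc, grp_inv_mul_grp, mul_one, sub_mul, smul_mul_assoc, one_mul] using h4

theorem contract_mulLeft_y (hφ : IsRightIntegralDual φ) (i : Fin n) (x : D.H) :
    contract (φ ∘ₗ LinearMap.mulLeft k (D.y i)) (D.comulHom x)
      = φ (D.y i * x) • D.grp (D.g i) - φ x • (D.grp (D.g i) * D.y i) := by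
  have h1 := (isRightIntegralDual_iff φ).mp hφ (D.y i * x)
  have h2 := (isRightIntegralDual_iff φ).mp hφ x
  rw [comul_apply] at h1 h2
  have h3 : D.y i ⊗ₜ[k] D.grp (D.g i)⁻¹ = (1 ⊗ₜ[k] D.grp (D.g i)⁻¹) * (D.y i ⊗ₜ[k] 1) := by simp
  rw [map_mul D.comulHom, comulHom_y, add_mul, map_add, contract_mul, h2, h3, mul_assoc,
    contract_mul, ← contract_comp_mulLeft, mul_smul_comm, mul_one] at h1
  have h4 := congrArg (D.grp (D.g i) * ·) (eq_sub_of_add_eq' h1)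
  simpa only [← mul_assoc, grp_mul_grp_inv, one_mul, mul_sub, mul_smul_comm, mul_one] using h4

/-- The discrepancy ψ of the two sides is a g_i-twisted integral. Uniqueness of integrals makes its
translate equal to cφ, and comparing `x` with its conjugate by g_i gives c (q_ii⁻¹ - 1) = 0. -/
theorem integral_y_mul (hφ : IsRightIntegralDual φ) (h0 : φ ≠ 0) (i : Fin n) (z : D.H) :
    φ (D.y i * z) = D.q i i * φ (z * D.y i) := by
  set γ := D.grp (D.g i) with hγ
  have hcomm : γ * D.y i = (D.q i i : k) • (D.y i * γ) := D.grp_mul_y _ i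
  have hcomm' : D.y i * γ = ((D.q i i)⁻¹ : k) • (γ * D.y i) := by
    rw [hcomm, smul_smul, inv_mul_cancel₀ (Units.ne_zero _), one_smul]
  have hinv : D.grp (D.g i)⁻¹ * D.y i = ((D.q i i)⁻¹ : k) • (D.y i * D.grp (D.g i)⁻¹) := by
    rw [grp_mul_y, map_inv, Units.val_inv_eq_inv_val]; rfl
  let ψ : Module.Dual k D.H := (D.q i i : k) • (φ ∘ₗ LinearMap.mulRight k (D.y i))
    - φ ∘ₗ LinearMap.mulLeft k (D.y i)
  have hψa : ∀ x, ψ x = D.q i i * φ (x * D.y i) - φ (D.y i * x) := fun x => rfl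
  -- The factor q_ii in ψ is chosen so that the terms φ(x) y_i g_i and φ(x) g_i y_i cancel.
  have hψ : ∀ x, contract ψ (D.comulHom x) = ψ x • γ := by
    intro x
    rw [contract_sub, contract_smul, contract_mulRight_y hφ, contract_mulLeft_y hφ, ← hγ, hcomm,
      hψa]
    module
  have hint : IsRightIntegralDual (ψ ∘ₗ LinearMap.mulLeft k γ) := by
    rw [isRightIntegralDual_iff]
    intro x
    have h1 := hψ (γ * x)
    have h2 : γ ⊗ₜ[k] γ = (1 ⊗ₜ[k] γ) * (γ ⊗ₜ[k] (1 : D.H)) := by simp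
    rw [map_mul, hγ, comulHom_grp, ← hγ, h2, mul_assoc, contract_mul,
      ← contract_comp_mulLeft] at h1
    have h3 := congrArg (D.grp (D.g i)⁻¹ * ·) h1
    rw [comul_apply, LinearMap.comp_apply, LinearMap.mulLeft_apply]
    simpa only [← mul_assoc, hγ, grp_inv_mul_grp, one_mul, mul_smul_comm] using h3
  obtain ⟨c, hc⟩ := integral_eq_smul hφ h0 hint
  have hc' : ∀ x, D.q i i * φ (γ * x * D.y i) - φ (D.y i * (γ * x)) = c * φ x := fun x =>
    LinearMap.congr_fun hc x
  have hc0 : c = 0 := by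
    obtain ⟨x, hx⟩ : ∃ x, φ x ≠ 0 := by
      by_contra! h
      exact h0 (LinearMap.ext h)
    have e1 := hc' x
    -- Conjugation multiplies φ by the top character, but the left-hand side acquires a further
    -- q_ii⁻¹ from moving y_i past g_i.
    have e2 := hc' (γ * x * D.grp (D.g i)⁻¹)
    have e3 : φ (γ * x * D.grp (D.g i)⁻¹) = D.topChar (D.g i) * φ x := by
      rw [mul_assoc, integral_grp_mul hφ, mul_assoc, grp_inv_mul_grp, mul_one]
    have e4 : φ (γ * (γ * x * D.grp (D.g i)⁻¹) * D.y i)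
        = (D.q i i : k)⁻¹ * (D.topChar (D.g i) * φ (γ * x * D.y i)) := by
      rw [mul_assoc γ, mul_assoc (γ * x), hinv, mul_smul_comm, mul_smul_comm, map_smul,
        smul_eq_mul, integral_grp_mul hφ]
      simp only [mul_assoc, grp_inv_mul_grp, mul_one]
    have e5 : φ (D.y i * (γ * (γ * x * D.grp (D.g i)⁻¹)))
        = (D.q i i : k)⁻¹ * (D.topChar (D.g i) * φ (D.y i * (γ * x))) := by
      rw [← mul_assoc (D.y i), hcomm', smul_mul_assoc, map_smul, smul_eq_mul, mul_assoc γ,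
        integral_grp_mul hφ]
      simp only [mul_assoc, grp_inv_mul_grp, mul_one]
    rw [e3, e4, e5] at e2
    have hq : (D.q i i : k) ≠ 0 := Units.ne_zero _
    have hτ : (D.topChar (D.g i) : k) ≠ 0 := Units.ne_zero _
    have e6 : c * φ x * D.topChar (D.g i) * ((D.q i i : k)⁻¹ - 1) = 0 := by
      linear_combination e2 - (D.q i i : k)⁻¹ * D.topChar (D.g i) * e1
    have hq1 : (D.q i i : k)⁻¹ - 1 ≠ 0 := by
      rw [sub_ne_zero, Ne, inv_eq_one]
      exact fun h => D.χ_self_ne_one i (Units.ext h)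
    simpa [hx, hτ, hq1] using e6
  have h1 := hc' (D.grp (D.g i)⁻¹ * z)
  rw [hc0, zero_mul, ← mul_assoc γ, hγ, grp_mul_grp_inv, one_mul] at h1
  exact (sub_eq_zero.mp h1).symm

theorem nakayama_grp (hφ : IsRightIntegralDual φ) (h0 : φ ≠ 0) {ρ : D.H ≃ₐ[k] D.H}
    (hρ : IsNakayamaAut φ ρ) (h : G) : ρ (D.grp h) = (D.topChar h)⁻¹ • D.grp h := by
  refine (isFrobeniusHom_integral h0 hφ).eq_of_forall_mul_left fun z => ?_
  rw [← hρ, smul_mul_assoc, Units.smul_def, map_smul, integral_grp_mul hφ, smul_eq_mul,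
    Units.inv_mul_cancel_left]

theorem nakayama_y (hφ : IsRightIntegralDual φ) (h0 : φ ≠ 0) {ρ : D.H ≃ₐ[k] D.H}
    (hρ : IsNakayamaAut φ ρ) (i : Fin n) : ρ (D.y i) = (D.q i i)⁻¹ • D.y i := by
  refine (isFrobeniusHom_integral h0 hφ).eq_of_forall_mul_left fun z => ?_
  rw [← hρ, smul_mul_assoc, Units.smul_def, map_smul, integral_y_mul hφ h0, smul_eq_mul,
    Units.inv_mul_cancel_left]

variable (D)

/-- The character of `∏ ℤ/m_i × G` giving the eigenvalues of the Nakayama automorphism. -/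
noncomputable def nakayamaChar : Multiplicative (∀ i, ZMod (D.m i)) × G →* kˣ where
  toFun p := (∏ i, (D.q i i)⁻¹ ^ (p.1.toAdd i).val) * (D.topChar p.2)⁻¹
  map_one' := by simp
  map_mul' p p' := by
    -- Exponents are added modulo m_i, which is harmless because m_i is the order of q_ii.
    have : ∀ i, (D.q i i)⁻¹ ^ ((p * p').1.toAdd i).val
        = (D.q i i)⁻¹ ^ (p.1.toAdd i).val * (D.q i i)⁻¹ ^ (p'.1.toAdd i).val := by
      intro i
      have h := pow_mod_orderOf (D.q i i)⁻¹ ((p.1.toAdd i).val + (p'.1.toAdd i).val)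
      rw [orderOf_inv] at h
      rw [Prod.fst_mul, toAdd_mul, Pi.add_apply, ZMod.val_add, ← pow_add]
      exact h
    simp only [this, Finset.prod_mul_distrib, Prod.snd_mul, map_mul, mul_inv]
    exact mul_mul_mul_comm _ _ _ _

theorem nakayamaChar_apply (r : ∀ i, ZMod (D.m i)) (h : G) :
    D.nakayamaChar (Multiplicative.ofAdd r, h)
      = (∏ i, (D.q i i)⁻¹ ^ (r i).val) * (D.topChar h)⁻¹ := rfl

variable {D}

theorem nakayama_monomial (hφ : IsRightIntegralDual φ) (h0 : φ ≠ 0) {ρ : D.H ≃ₐ[k] D.H}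
    (hρ : IsNakayamaAut φ ρ) (r : ∀ i, ZMod (D.m i)) (h : G) :
    ρ (D.monomial r h)
      = (D.nakayamaChar (Multiplicative.ofAdd r, h) : k) • D.monomial r h := by
  rw [← Units.smul_def, nakayamaChar_apply, monomial_eq, map_mul, map_list_prod, List.map_ofFn,
    nakayama_grp hφ h0 hρ]
  simp only [Function.comp_def, map_pow, nakayama_y hφ h0 hρ, smul_pow]
  rw [List.prod_ofFn_smul, smul_mul_smul_comm]

/-- The element t representing the counit through φ is a right integral, and nondegeneracy gives a t
= φ(a t) t. -/
theorem exists_modular (hφ : IsRightIntegralDual φ) (h0 : φ ≠ 0) :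
    ∃ α : Module.Dual k D.H, IsModularElement α := by
  have hF := isFrobeniusHom_integral h0 hφ
  obtain ⟨t, ht⟩ := hF.exists_mul_left D.counitHom.toLinearMap
  have hint : ∀ a, t * a = D.counitHom a • t := fun a =>
    hF.eq_of_forall_mul_left fun y => by
      rw [mul_assoc, ht, smul_mul_assoc, map_smul, ht]
      simp
  refine ⟨φ ∘ₗ LinearMap.mulRight k t, t, ?_, hint, fun a => ?_⟩
  · rintro rfl
    simpa using ht 1
  · refine hF.eq_of_forall_mul_left fun y => ?_
    rw [mul_assoc, hint, mul_smul_comm, map_smul, smul_mul_assoc, map_smul, ht]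
    simp [mul_comm]

/-- Evaluate φ(ht) = χ(h) φ(th) on a right integral t. Here φ(t) ≠ 0, since otherwise φ(ty) = ε(y)
φ(t) would vanish for all y. -/
theorem modular_grp (hφ : IsRightIntegralDual φ) (h0 : φ ≠ 0) {α : Module.Dual k D.H}
    (hα : IsModularElement α) (h : G) : α (D.grp h) = D.topChar h := by
  obtain ⟨t, ht0, ht, hα⟩ := hα
  have hφt : φ t ≠ 0 := by
    intro h1
    refine ht0 ((isFrobeniusHom_integral h0 hφ).eq_of_forall_mul_left fun y => ?_)
    rw [ht, map_smul, h1, smul_zero, zero_mul, map_zero]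
  have h1 := integral_grp_mul hφ h t
  rw [hα, ht, map_smul, counit_apply, counitHom_grp, one_smul, smul_eq_mul] at h1
  exact mul_right_cancel₀ hφt h1

/-- The eigenvalues of y_i and h are the inverses of the generators of the subgroup. -/
theorem range_nakayamaChar (hφ : IsRightIntegralDual φ) (h0 : φ ≠ 0) {α : Module.Dual k D.H}
    (hα : IsModularElement α) : D.nakayamaChar.range = D.L₁ α := by
  apply le_antisymm
  · rintro _ ⟨⟨r, h⟩, rfl⟩
    have hq : ∀ i, D.q i i ∈ D.L₁ α := fun i => Subgroup.subset_closure (Or.inl ⟨i, rfl⟩)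
    have hτ : D.topChar h ∈ D.L₁ α :=
      Subgroup.subset_closure (Or.inr ⟨h, (modular_grp hφ h0 hα h).symm⟩)
    exact Subgroup.mul_mem _ (Subgroup.prod_mem _ fun i _ =>
      Subgroup.pow_mem _ (Subgroup.inv_mem _ (hq i)) _) (Subgroup.inv_mem _ hτ)
  · rw [L₁, Subgroup.closure_le]
    rintro _ (⟨i, rfl⟩ | ⟨h, hu⟩)
    · rw [SetLike.mem_coe, ← inv_mem_iff]
      have : Fact (1 < D.m i) := ⟨D.one_lt_m i⟩
      refine ⟨(Multiplicative.ofAdd (Pi.single i 1), 1), ?_⟩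
      rw [nakayamaChar_apply, map_one, inv_one, mul_one, Finset.prod_eq_single i]
      · rw [Pi.single_eq_same, ZMod.val_one, pow_one]
      · intro j _ hj
        simp [hj]
      · simp
    · rw [SetLike.mem_coe, ← inv_mem_iff]
      rw [modular_grp hφ h0 hα] at hu
      refine ⟨(1, h), ?_⟩
      rw [Units.ext hu]
      exact (D.nakayamaChar_apply 0 h).trans (by simp)

end LiftingDatum

theorem mainTheorem7 {k G : Type*} [Field k] [CommGroup G] [Finite G] {n : ℕ}
    (D : LiftingDatum k G n) :
    -- nonzero right integrals in the dual of `H`, and the modular element, exist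
    (∃ φ : Module.Dual k D.H, φ ≠ 0 ∧ IsRightIntegralDual φ) ∧
    (∃ α : Module.Dual k D.H, IsModularElement α) ∧
    -- the given elements form a basis of `H`
    (∃ b : Module.Basis ((∀ i, ZMod (D.m i)) × G) k D.H, ∀ r h, b (r, h) = D.monomial r h) ∧
    ∀ φ : Module.Dual k D.H, φ ≠ 0 → IsRightIntegralDual φ →
      -- the Nakayama automorphism is well defined
      IsFrobeniusHom φ ∧ (∃! ρ : D.H ≃ₐ[k] D.H, IsNakayamaAut φ ρ) ∧
      ∀ ρ : D.H ≃ₐ[k] D.H, IsNakayamaAut φ ρ →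
        -- the basis elements are eigenvectors, with eigenvalues given by a homomorphism
        (∃ θ : Multiplicative (∀ i, ZMod (D.m i)) × G →* kˣ, ∀ r h,
          ρ (D.monomial r h) = (θ (Multiplicative.ofAdd r, h) : k) • D.monomial r h) ∧
        ∀ α : Module.Dual k D.H, IsModularElement α →
          -- `L₁` is the set of eigenvalues, `H` is the direct sum of the components,
          -- and these all have the same dimension
          (∀ z : k, D.component ρ z ≠ ⊥ ↔ ∃ ω ∈ D.L₁ α, (ω : k) = z) ∧
          iSupIndep (fun ω : D.L₁ α => D.component ρ ((ω : kˣ) : k)) ∧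
          (⨆ ω : D.L₁ α, D.component ρ ((ω : kˣ) : k)) = ⊤ ∧
          ∀ ω ∈ D.L₁ α, ∀ ω' ∈ D.L₁ α,
            Module.finrank k (D.component ρ (ω : k)) = Module.finrank k (D.component ρ (ω' : k)) := by
  obtain ⟨φ₀, hφ₀, hint₀⟩ := D.exists_integral
  refine ⟨D.exists_integral, LiftingDatum.exists_modular hint₀ hφ₀, D.exists_basis_monomial, ?_⟩
  intro φ h0 hφ
  have hF := LiftingDatum.isFrobeniusHom_integral h0 hφ
  refine ⟨hF, hF.existsUnique_nakayama, fun ρ hρ =>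
    ⟨⟨D.nakayamaChar, LiftingDatum.nakayama_monomial hφ h0 hρ⟩, fun α hα => ?_⟩⟩
  -- The index set is made multiplicative so that the eigenvalue function is a homomorphism on it.
  let b := D.basis.reindex (Equiv.prodCongr Multiplicative.ofAdd (Equiv.refl G))
  have hb : ∀ p, (ρ : D.H →ₗ[k] D.H) (b p) = (D.nakayamaChar p : k) • b p := by
    intro p
    simp only [b, Module.Basis.reindex_apply, D.basis_apply]
    exact LiftingDatum.nakayama_monomial hφ h0 hρ _ _
  rw [← LiftingDatum.range_nakayamaChar hφ h0 hα]
  refine ⟨fun z => ?_, ?_, iSup_eigenspace_eq_top hb, ?_⟩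
  · rw [LiftingDatum.component, eigenspace_ne_bot_iff hb]
    simp
  · exact (Module.End.eigenspaces_iSupIndep (ρ : D.H →ₗ[k] D.H)).comp
      (Units.val_injective.comp Subtype.val_injective)
  · rintro _ ⟨p, rfl⟩ _ ⟨p', rfl⟩
    exact (finrank_eigenspace_eq hb p).trans (finrank_eigenspace_eq hb p').symm
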